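/- **Setting.** Let $\gamma=\bigotimes_{j\in\mathbb N}\mathcal N(0,1)$ on $\mathbb R^\infty=\mathbb R^{\mathbb N}$ and $\gamma_N=\bigotimes_{j=1}^N\mathcal N(0,1)$ on $\mathbb R^N$. Let $X$ be a complex separable Hilbert space, $\boldsymbol b=(b_j)_{j\in\mathbb N}\in(0,\infty)^\infty$, and $\xi,\delta>0$. For $N\in\mathbb N=\{1,2,\dots\}$ call $\boldsymbol\varrho\in(0,\infty)^N$ *admissible* if $\sum_{j=1}^N b_j^2\varrho_j^2\le\xi^2$, and put $\mathcal S_{\boldsymbol\varrho}=\{z\in\mathbb C^N:|\operatorname{Im}z_j|<\varrho_j\ \forall j\}$, $\mathcal B(\boldsymbol\varrho)=\{z\in\mathbb C^N:|z_j|<\varrho_j\ \forall j\}$. A function $u\in L^2_\gamma(\mathbb R^\infty,X)$ is *$(\boldsymbol b,\xi,2,\delta,X)$-holomorphic* if there are functions $u_N:\mathbb R^N\to X$ and $\varphi_N:\mathbb R^N\to[0,\infty)$ $(N\in\mathbb N)$ such that 1. for every $N$ and every admissible $\boldsymbol\varrho\in(0,\infty)^N$, $u_N$ has a holomorphic extension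 $\mathcal S_{\boldsymbol\varrho}\to X$ (again denoted $u_N$), and $u_N(y_1,\dots,y_N)=u_L(y_1,\dots,y_N,0,\dots,0)$ for all $N<L$ and $y\in\mathbb R^N$; 2. $\|\varphi_N\|_{L^2_{\gamma_N}(\mathbb R^N)}\le\delta$, and $\|u_N(y+z)\|_X\le\varphi_N(y)$ for all $N$, all $y\in\mathbb R^N$, all admissible $\boldsymbol\varrho\in(0,\infty)^N$ and all $z\in\mathcal B(\boldsymbol\varrho)$; 3. with $\tilde u_N(y):=u_N(y_1,\dots,y_N)$ for $y\in\mathbb R^\infty$, $\lim_{N\to\infty}\|u-\tilde u_N\|_{L^2_\gamma(\mathbb R^\infty,X)}=0$. Let $\mathcal F$ be the set of finitely supported $\boldsymbol\nu\in\mathbb N_0^\infty$. Let $H_k$ be the Hermite polynomials, orthonormal in $L^2(\mathcal N(0,1))$, and let $H_{\boldsymbol\nu}(y)=\prod_j H_{\nu_j}(y_j)$ and $u_{\boldsymbol\nu}=\int_{\mathbb R^\infty}u(y)H_{\boldsymbol\nu}(y)\,\gamma(dy)\in X$ for $\boldsymbol\nu\in\mathcal F$. **Theorem.** Let $u$ be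 $(\boldsymbol b,\xi,2,\delta,X)$-holomorphic with $\boldsymbol b\in\ell^p(\mathbb N)$ for some $p\in(0,2)$. Let $M\in\mathbb N$ with $M>2/p$, and let $\varrho_j>0$ be given by $$\varrho_j^2b_j^2=\Big(\frac{b_j}{\|\boldsymbol b\|_{\ell^p}}\Big)^p\frac{\xi^2}{8e\,M!},\qquad j\in\mathbb N .$$ Let $K>0$ and $$c_{\boldsymbol\nu}=\prod_{j\in\operatorname{supp}\boldsymbol\nu}\max\{1,K\varrho_j\}^2\,\nu_j^M,\qquad\boldsymbol\nu\in\mathcal F .$$ Let $(\boldsymbol\nu_i)_{i\in\mathbb N}$ be any enumeration of $\mathcal F$ (each element occurring exactly once) such that $c_{\boldsymbol\nu_i}\le c_{\boldsymbol\nu_j}$ whenever $i\le j$, and let $\Lambda_N=\{\boldsymbol\nu_i: i\le N\}$. Then $$\Big\|u-\sum_{\boldsymbol\nu\in\Lambda_N}u_{\boldsymbol\nu}H_{\boldsymbol\nu}\Big\|_{L^2_\gamma(\mathbb R^\infty,X)}=\mathcal O\big(N^{-\frac1p+\frac12}\big)\qquad\text{as }N\to\infty .$$ -/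

import Mathlib

open MeasureTheory ProbabilityTheory Filter Topology
open scoped Nat ENNReal

namespace HermiteApprox

/-- The product Gaussian measure `⨂_{j < N} N(0, 1)` on `ℝ^N`. -/
noncomputable def gammaFin (N : ℕ) : Measure (Fin N → ℝ) :=
  Measure.pi fun _ => gaussianReal 0 1

/-- The countable product Gaussian measure `⨂_{j ∈ ℕ} N(0, 1)` on `ℝ^∞`. -/
noncomputable def gammaInf : Measure (ℕ → ℝ) :=
  Measure.infinitePi fun _ => gaussianReal 0 1

/-- The open strip `{z ∈ ℂ^N : |Im z_j| < ϱ_j for all j}`. -/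
def strip {N : ℕ} (ϱ : Fin N → ℝ) : Set (Fin N → ℂ) :=
  {z | ∀ j, |(z j).im| < ϱ j}

/-- The open polydisc `{z ∈ ℂ^N : |z_j| < ϱ_j for all j}`. -/
def polydisc {N : ℕ} (ϱ : Fin N → ℝ) : Set (Fin N → ℂ) :=
  {z | ∀ j, ‖z j‖ < ϱ j}

/-- A real vector regarded as a complex vector. -/
def toComplex {N : ℕ} (y : Fin N → ℝ) : Fin N → ℂ := fun j => (y j : ℂ)

/-- The vector `(y_1, …, y_N, 0, …, 0) ∈ ℝ^L`, for `y ∈ ℝ^N` and `N ≤ L`. -/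
def padZero {N : ℕ} (L : ℕ) (y : Fin N → ℝ) : Fin L → ℝ :=
  fun j => if h : (j : ℕ) < N then y ⟨j, h⟩ else 0

/-- `ϱ ∈ (0, ∞)^N` is `(b, ξ, 2)`-admissible: `∑_{j ≤ N} b_j² ϱ_j² ≤ ξ²`. -/
def Admissible (b : ℕ → ℝ) (ξ : ℝ) {N : ℕ} (ϱ : Fin N → ℝ) : Prop :=
  (∀ j, 0 < ϱ j) ∧ ∑ j : Fin N, b j ^ 2 * ϱ j ^ 2 ≤ ξ ^ 2

/-- `(b, ξ, 2, δ, X)`-holomorphy of `u ∈ L²_γ(ℝ^∞, X)`. The function `U N ϱ` is the holomorphic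
extension of `uN N` to the strip of widths `ϱ`; it is determined there by `uN N`. The index `N`
runs over the positive integers. -/
def IsHolomorphic {X : Type*} [NormedAddCommGroup X] [InnerProductSpace ℂ X]
    (b : ℕ → ℝ) (ξ δ : ℝ) (u : (ℕ → ℝ) → X) : Prop :=
  MemLp u 2 gammaInf ∧
  ∃ (uN : ∀ N : ℕ, (Fin N → ℝ) → X) (U : ∀ N : ℕ, (Fin N → ℝ) → (Fin N → ℂ) → X)
    (phi : ∀ N : ℕ, (Fin N → ℝ) → ℝ),
    -- holomorphic extensions
    (∀ N, 1 ≤ N → ∀ ϱ : Fin N → ℝ, Admissible b ξ ϱ →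
      DifferentiableOn ℂ (U N ϱ) (strip ϱ) ∧ ∀ y : Fin N → ℝ, U N ϱ (toComplex y) = uN N y) ∧
    -- consistency
    (∀ N L, 1 ≤ N → N < L → ∀ y : Fin N → ℝ, uN N y = uN L (padZero L y)) ∧
    -- the bounds by `phi`
    (∀ N, 1 ≤ N → (∀ y, 0 ≤ phi N y) ∧ MemLp (phi N) 2 (gammaFin N) ∧
      eLpNorm (phi N) 2 (gammaFin N) ≤ ENNReal.ofReal δ) ∧
    (∀ N, 1 ≤ N → ∀ ϱ : Fin N → ℝ, Admissible b ξ ϱ → ∀ z ∈ polydisc ϱ, ∀ y : Fin N → ℝ,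
      ‖U N ϱ (toComplex y + z)‖ ≤ phi N y) ∧
    -- convergence
    Tendsto (fun N => eLpNorm (fun y : ℕ → ℝ => u y - uN N (fun j => y j)) 2 gammaInf)
      atTop (𝓝 0)

/-- The `k`-th Hermite polynomial, orthonormal with respect to `N(0, 1)`:
`He_k / √(k!)` with the monic (probabilists') Hermite polynomial `He_k`. -/
noncomputable def hermiteFun (k : ℕ) (x : ℝ) : ℝ :=
  Polynomial.aeval x (Polynomial.hermite k) / √(k ! : ℝ)

/-- The tensorized Hermite polynomial `H_ν(y) = ∏_j H_{ν_j}(y_j)`, for `ν` of finite support. -/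
noncomputable def hermiteMulti (ν : ℕ →₀ ℕ) (y : ℕ → ℝ) : ℝ :=
  ν.prod fun j k => hermiteFun k (y j)

/-- The Wiener-Hermite coefficient `u_ν = ∫ u(y) H_ν(y) γ(dy)`. -/
noncomputable def hermiteCoeff {X : Type*} [NormedAddCommGroup X] [InnerProductSpace ℂ X]
    (u : (ℕ → ℝ) → X) (ν : ℕ →₀ ℕ) : X :=
  ∫ y, hermiteMulti ν y • u y ∂gammaInf

/-- The weight `c_ν = ∏_{j ∈ supp ν} max {1, K ϱ_j}² ν_j^M`. -/
noncomputable def weight (K : ℝ) (ϱ : ℕ → ℝ) (M : ℕ) (ν : ℕ →₀ ℕ) : ℝ :=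
  ν.prod fun j k => max 1 (K * ϱ j) ^ 2 * (k : ℝ) ^ M

/-- The norm (a quasi-norm if `p < 1`) of `b` in `ℓ^p(ℕ)`, for a positive sequence `b` in that
space. -/
noncomputable def lpQuasiNorm (p : ℝ) (b : ℕ → ℝ) : ℝ :=
  (∑' j, b j ^ p) ^ (1 / p)

/-- The set `Λ_N` of the first `N` multi-indices of an enumeration `e`. -/
def firstIndices (e : ℕ ≃ (ℕ →₀ ℕ)) (N : ℕ) : Finset (ℕ →₀ ℕ) :=
  (Finset.range N).map e.toEmbedding

/-- The truncated Wiener-Hermite expansion `∑_{ν ∈ Λ} u_ν H_ν(y)`. -/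
noncomputable def truncation {X : Type*} [NormedAddCommGroup X] [InnerProductSpace ℂ X]
    (u : (ℕ → ℝ) → X) (Λ : Finset (ℕ →₀ ℕ)) (y : ℕ → ℝ) : X :=
  ∑ ν ∈ Λ, hermiteMulti ν y • hermiteCoeff u ν

end HermiteApprox

/-!
The Hermite coefficients of `u` satisfy a weighted `ℓ²` bound whose weights grow at least like
`weight K ϱ M`, and the reciprocal weights have a summable power. Along an enumeration that sorts
the weights, the discarded coefficients therefore have large weights, and Parseval's identity turns
this into the rate.

The weighted bound. For one variable and `f` holomorphic near the real line, the average of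
`e^{-ilθ} f (y + κ e^{iθ})` over `θ` is a multiple of the `l`-th derivative of `f` at `y`, and `l`
Gaussian integrations by parts identify the coefficient of `(θ, y) ↦ f (y + κ e^{iθ})` with respect
to the orthonormal system `e^{ilθ} H_m(y)` as an explicit multiple of the `H_{m+l}`-coefficient of
`f` (`integral_conj_waveHermite_smul`). Replacing one coordinate at a time with Fubini's theorem
gives the same identity for functions of `N` variables (`integral_conj_prod_waveHermite_smul`), so
neither derivatives nor Cauchy integrals in several variables are needed. On the torus of radii `κ`
the function is bounded by the majorant `phi N`, whose `L²` norm is at most `δ`. Bessel's inequality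
for all pairs `(l, m)` with `l + m = ν` then bounds the sum of
`(∏ j, shiftWeight (κ j) (ν j)) * ‖u_ν‖²` by `δ²` (`sum_prod_shiftWeight_mul_le`). Here
`shiftWeight κ n = ∑ l, n.choose l * κ ^ (2 * l) / l !`. The bound does not depend on `N` and passes
to the limit (`IsHolomorphic.sum_prod_shiftWeight_mul_le`).

Choice of the radii. The terms `l = 1` and `l = M` show that `shiftWeight κ n` is at least a
constant times `κ ^ 2 * n ^ M` if `1 ≤ κ` (`le_shiftWeight`). This constant and `K` enter in every
coordinate, so they must not be lost: outside a finite set of coordinates one takes `κ` to be a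
large multiple of `ϱ`, which is admissible since `∑ j, b j ^ 2 * ϱ j ^ 2` converges and hence has
small tails. In the finitely many other coordinates the radius is small, at the cost of one constant
(`exists_radii`).

Parseval's identity needs the completeness of the Hermite polynomials in `L²(gammaInf, X)`
(`eq_zero_of_coeffWith_hermiteC`). A function orthogonal to all of them is orthogonal to all
characters of finitely many coordinates, because `exp |Z|` is square integrable for every linear
form `Z` in finitely many coordinates. Finite measures on the sequence space are determined by
their finite-dimensional characteristic functions.
-/

namespace HermiteApprox

/-! ### Hermite polynomials and the one-dimensional Gaussian measure -/

@[simp]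
lemma hermiteFun_zero (x : ℝ) : hermiteFun 0 x = 1 := by
  simp [hermiteFun]

lemma integrable_pow_gaussianReal (n : ℕ) :
    Integrable (fun x : ℝ => x ^ n) (gaussianReal 0 1) :=
  integrable_pow_of_mem_interior_integrableExpSet (X := fun x : ℝ => x)
    (by simp [integrableExpSet_fun_id_gaussianReal]) n

lemma integrable_aeval_gaussianReal (P : Polynomial ℤ) :
    Integrable (fun x : ℝ => Polynomial.aeval x P) (gaussianReal 0 1) := by
  simp_rw [Polynomial.aeval_eq_sum_range]
  refine integrable_finsetSum _ fun i _ => ?_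
  simp_rw [zsmul_eq_mul]
  exact (integrable_pow_gaussianReal i).const_mul _

lemma memLp_aeval_gaussianReal (P : Polynomial ℤ) :
    MemLp (fun x : ℝ => Polynomial.aeval x P) 2 (gaussianReal 0 1) := by
  rw [memLp_two_iff_integrable_sq (Polynomial.continuous_aeval P).aestronglyMeasurable]
  convert integrable_aeval_gaussianReal (P ^ 2) using 2 with x
  exact (map_pow (Polynomial.aeval x) P 2).symm

lemma continuous_hermiteFun (k : ℕ) : Continuous (hermiteFun k) :=
  (Polynomial.continuous_aeval _).div_const _

lemma memLp_hermiteFun (k : ℕ) : MemLp (hermiteFun k) 2 (gaussianReal 0 1) := by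
  have := (memLp_aeval_gaussianReal (Polynomial.hermite k)).const_mul (√(k ! : ℝ))⁻¹
  refine this.congr_norm (continuous_hermiteFun k).aestronglyMeasurable (ae_of_all _ fun x => ?_)
  simp [hermiteFun, div_eq_inv_mul]

lemma derivative_hermite_succ (n : ℕ) :
    Polynomial.derivative (Polynomial.hermite (n + 1)) =
      ((n + 1 : ℕ) : Polynomial ℤ) * Polynomial.hermite n := by
  induction n with
  | zero => simp
  | succ n ih =>
    rw [Polynomial.hermite_succ (n + 1), Polynomial.derivative_sub, Polynomial.derivative_mul, ih]
    simp only [Polynomial.derivative_X, Polynomial.derivative_natCast_mul]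
    rw [Polynomial.hermite_succ n]
    push_cast
    ring

lemma sqrt_factorial_succ (n : ℕ) : √((n + 1)! : ℝ) = √(n + 1 : ℝ) * √(n ! : ℝ) := by
  rw [← Real.sqrt_mul (by positivity), Nat.factorial_succ]
  push_cast
  rfl

/-- The three-term recursion of the normalized Hermite polynomials. -/
lemma mul_hermiteFun (n : ℕ) (x : ℝ) :
    x * hermiteFun n x =
      √(n + 1 : ℝ) * hermiteFun (n + 1) x + √(n : ℝ) * hermiteFun (n - 1) x := by
  cases n with
  | zero => simp [hermiteFun]
  | succ n =>
    have h1 : x * Polynomial.aeval x (Polynomial.hermite (n + 1)) =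
        Polynomial.aeval x (Polynomial.hermite (n + 2)) +
          (n + 1 : ℝ) * Polynomial.aeval x (Polynomial.hermite n) := by
      rw [Polynomial.hermite_succ (n + 1), derivative_hermite_succ]
      simp
    have e1 := sqrt_factorial_succ (n + 1)
    have e2 := sqrt_factorial_succ n
    push_cast at e1 ⊢
    simp only [hermiteFun]
    rw [e1, e2, mul_div_assoc', h1]
    have p1 : √(n + 1 : ℝ) ≠ 0 := by positivity
    have p2 : √(n ! : ℝ) ≠ 0 := by positivity
    have p3 : √(n + 1 + 1 : ℝ) ≠ 0 := by positivity
    field_simp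
    rw [Real.sq_sqrt (by positivity)]
    ring

lemma hasDerivAt_gaussianPDFReal (x : ℝ) :
    HasDerivAt (gaussianPDFReal 0 1) (-x * gaussianPDFReal 0 1 x) x := by
  have hw : gaussianPDFReal 0 1 =
      fun x : ℝ => (√(2 * Real.pi * 1))⁻¹ * Real.exp (-x ^ 2 / (2 * 1)) := by
    ext x
    simp [gaussianPDFReal]
  have hx : HasDerivAt (fun x : ℝ => x ^ 2) (2 * x) x := by
    simpa using hasDerivAt_pow 2 x
  rw [hw]
  refine ((hx.fun_neg.div_const (2 * 1)).exp.const_mul (√(2 * Real.pi * 1))⁻¹).congr_deriv ?_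
  ring

/-- `H_{m+1}` times the Gaussian density is, up to a factor, the derivative of `H_m` times the
density. -/
lemma hasDerivAt_gaussianPDFReal_mul_hermiteFun (m : ℕ) (x : ℝ) :
    HasDerivAt (fun x => gaussianPDFReal 0 1 x * hermiteFun m x)
      (-(√(m + 1 : ℝ) * (gaussianPDFReal 0 1 x * hermiteFun (m + 1) x))) x := by
  have h1 : HasDerivAt (hermiteFun m)
      (Polynomial.aeval x (Polynomial.derivative (Polynomial.hermite m)) / √(m ! : ℝ)) x :=
    (Polynomial.hasDerivAt_aeval _ x).div_const _
  refine ((hasDerivAt_gaussianPDFReal x).mul h1).congr_deriv ?_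
  simp only [hermiteFun]
  rw [Polynomial.hermite_succ, sqrt_factorial_succ]
  have p1 : √(m + 1 : ℝ) ≠ 0 := by positivity
  have p2 : √(m ! : ℝ) ≠ 0 := by positivity
  simp only [map_sub, map_mul, Polynomial.aeval_X]
  field_simp
  ring

section Vector

variable {X : Type*} [NormedAddCommGroup X] [NormedSpace ℝ X]

lemma integrable_gaussianReal_iff {f : ℝ → X} :
    Integrable f (gaussianReal 0 1) ↔ Integrable fun x => gaussianPDFReal 0 1 x • f x := by
  rw [gaussianReal_of_var_ne_zero 0 one_ne_zero,
    integrable_withDensity_iff_integrable_smul' (measurable_gaussianPDF 0 1)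
      (ae_of_all _ fun _ => gaussianPDF_lt_top)]
  simp [toReal_gaussianPDF]

/-- Gaussian integration by parts. -/
lemma integral_hermiteFun_smul_deriv [CompleteSpace X] (m : ℕ) {f f' : ℝ → X}
    (hf : ∀ x, HasDerivAt f (f' x) x)
    (h0 : Integrable (fun x => hermiteFun m x • f x) (gaussianReal 0 1))
    (h1 : Integrable (fun x => hermiteFun (m + 1) x • f x) (gaussianReal 0 1))
    (h2 : Integrable (fun x => hermiteFun m x • f' x) (gaussianReal 0 1)) :
    ∫ x, hermiteFun m x • f' x ∂gaussianReal 0 1 =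
      √(m + 1 : ℝ) • ∫ x, hermiteFun (m + 1) x • f x ∂gaussianReal 0 1 := by
  rw [integrable_gaussianReal_iff] at h0 h1 h2
  simp only [integral_gaussianReal_eq_integral_smul one_ne_zero]
  rw [← integral_smul, ← sub_eq_zero, ← integral_sub h2 (h1.fun_smul _)]
  refine integral_eq_zero_of_hasDerivAt_of_integrable
    (f := fun x => (gaussianPDFReal 0 1 x * hermiteFun m x) • f x) (fun x => ?_)
    (h2.sub (h1.smul _)) ?_
  · refine ((hasDerivAt_gaussianPDFReal_mul_hermiteFun m x).smul (hf x)).congr_deriv ?_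
    simp only [smul_smul, neg_smul, sub_eq_add_neg]
  · simpa only [smul_smul] using h0

end Vector

lemma integrable_hermiteFun_mul_aeval (m : ℕ) (P : Polynomial ℤ) :
    Integrable (fun x => hermiteFun m x • (Polynomial.aeval x P : ℝ)) (gaussianReal 0 1) :=
  (memLp_hermiteFun m).integrable_mul (memLp_aeval_gaussianReal P)

lemma integral_hermiteFun_mul_derivative (m : ℕ) (P : Polynomial ℤ) :
    ∫ x, hermiteFun m x * Polynomial.aeval x (Polynomial.derivative P) ∂gaussianReal 0 1 =
      √(m + 1 : ℝ) * ∫ x, hermiteFun (m + 1) x * Polynomial.aeval x P ∂gaussianReal 0 1 :=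
  integral_hermiteFun_smul_deriv m (fun x => Polynomial.hasDerivAt_aeval P x)
    (integrable_hermiteFun_mul_aeval _ _) (integrable_hermiteFun_mul_aeval _ _)
    (integrable_hermiteFun_mul_aeval _ _)

lemma integral_hermiteFun_mul_aeval (m : ℕ) (P : Polynomial ℤ) :
    √(m ! : ℝ) * ∫ x, hermiteFun m x * Polynomial.aeval x P ∂gaussianReal 0 1 =
      ∫ x, Polynomial.aeval x (Polynomial.derivative^[m] P) ∂gaussianReal 0 1 := by
  induction m generalizing P with
  | zero => simp
  | succ m ih =>
    rw [Function.iterate_succ_apply, ← ih, integral_hermiteFun_mul_derivative,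
      sqrt_factorial_succ]
    ring

/-- The normalized Hermite polynomials are orthonormal with respect to `N(0, 1)`. -/
lemma integral_hermiteFun_mul_hermiteFun (m n : ℕ) :
    ∫ x, hermiteFun m x * hermiteFun n x ∂gaussianReal 0 1 = if m = n then 1 else 0 := by
  wlog h : n ≤ m generalizing m n
  · have := this n m (by omega)
    simp only [mul_comm (hermiteFun m _), this, eq_comm]
  have key := integral_hermiteFun_mul_aeval m (Polynomial.hermite n)
  have p2 : √(m ! : ℝ) ≠ 0 := by positivity
  have e : ∫ x, hermiteFun m x * hermiteFun n x ∂gaussianReal 0 1 =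
      (√(n ! : ℝ))⁻¹ * ∫ x, hermiteFun m x * Polynomial.aeval x (Polynomial.hermite n)
        ∂gaussianReal 0 1 := by
    rw [← integral_const_mul]
    congr 1
    ext x
    simp only [hermiteFun]
    ring
  rw [e]
  rcases h.lt_or_eq with h | rfl
  · rw [Polynomial.iterate_derivative_eq_zero (by simpa using h)] at key
    simp only [map_zero, integral_zero, mul_eq_zero, p2, false_or] at key
    simp [key, h.ne']
  · have hd : Polynomial.derivative^[n] (Polynomial.hermite n) = ((n ! : ℕ) : Polynomial ℤ) := by
      ext k
      rw [Polynomial.coeff_iterate_derivative, Polynomial.coeff_natCast_ite]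
      split_ifs with hk
      · subst hk
        simp [Polynomial.coeff_hermite_self, Nat.descFactorial_self]
      · rw [Polynomial.coeff_hermite_of_lt (by omega)]
        simp
    rw [hd] at key
    simp only [map_natCast, integral_const, probReal_univ, one_smul] at key
    rw [if_pos rfl, ← mul_right_inj' p2, mul_one, mul_left_comm, key, inv_mul_eq_div,
      Real.div_sqrt]

/-! ### Averages over circles -/

/-- The uniform probability measure on `(0, 2π]`, used to average over circles. -/
noncomputable def angleMeasure : Measure ℝ :=
  (ENNReal.ofReal (2 * Real.pi))⁻¹ • volume.restrict (Set.Ioc 0 (2 * Real.pi))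

instance : IsProbabilityMeasure angleMeasure := by
  refine ⟨?_⟩
  have h : (0 : ℝ) < 2 * Real.pi := by positivity
  simp only [angleMeasure, Measure.smul_apply, Measure.restrict_apply MeasurableSet.univ,
    Set.univ_inter, Real.volume_Ioc, sub_zero, smul_eq_mul]
  exact ENNReal.inv_mul_cancel (by simpa using h) ENNReal.ofReal_ne_top

lemma integral_angleMeasure {X : Type*} [NormedAddCommGroup X] [NormedSpace ℝ X] (f : ℝ → X) :
    ∫ θ, f θ ∂angleMeasure = (2 * Real.pi)⁻¹ • ∫ θ in (0)..(2 * Real.pi), f θ := by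
  rw [angleMeasure, integral_smul_measure, intervalIntegral.integral_of_le (by positivity)]
  rw [ENNReal.toReal_inv, ENNReal.toReal_ofReal (by positivity)]

lemma integral_exp_mul_I (n : ℤ) :
    ∫ θ : ℝ, Complex.exp (n * θ * Complex.I) ∂angleMeasure = if n = 0 then 1 else 0 := by
  rw [integral_angleMeasure]
  split_ifs with h
  · have h2 : (Real.pi : ℂ) ≠ 0 := by exact_mod_cast Real.pi_ne_zero
    simp only [h, Int.cast_zero, zero_mul, Complex.exp_zero, intervalIntegral.integral_const,
      sub_zero, smul_smul]
    rw [inv_mul_cancel₀ (by positivity), one_smul]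
  · have hc : (n * Complex.I : ℂ) ≠ 0 := by simp [h]
    have := integral_exp_mul_complex (a := 0) (b := 2 * Real.pi) hc
    simp_rw [mul_right_comm]
    rw [this]
    have e : (n * Complex.I * (2 * Real.pi : ℝ) : ℂ) = n * (2 * Real.pi * Complex.I) := by
      push_cast
      ring
    rw [e, Complex.exp_int_mul_two_pi_mul_I]
    simp

section Circle

variable {X : Type*} [NormedAddCommGroup X] [NormedSpace ℂ X]

/-- The Taylor coefficients of a holomorphic function as Fourier coefficients on a circle. -/
lemma integral_exp_smul_circle [CompleteSpace X] {f : ℂ → X} {c : ℂ} {R : ℝ} (hR : 0 < R)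
    (hf : DiffContOnCl ℂ f (Metric.ball c R)) (l : ℕ) :
    ∫ θ : ℝ, Complex.exp (-(l * θ * Complex.I)) • f (c + R * Complex.exp (θ * Complex.I))
      ∂angleMeasure = (R ^ l / l ! : ℝ) • iteratedDeriv l f c := by
  have h := DiffContOnCl.circleIntegral_one_div_sub_center_pow_smul hR l hf
  have hl : (l ! : ℂ) ≠ 0 := by exact_mod_cast Nat.factorial_ne_zero l
  have hRc : (R : ℂ) ≠ 0 := by exact_mod_cast hR.ne'
  have hp : (Real.pi : ℂ) ≠ 0 := by exact_mod_cast Real.pi_ne_zero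
  have e : ∀ θ : ℝ, Complex.exp (-(l * θ * Complex.I)) • f (c + R * Complex.exp (θ * Complex.I)) =
      (R ^ l / Complex.I : ℂ) • (deriv (circleMap c R) θ •
        ((1 / (circleMap c R θ - c) ^ (l + 1)) • f (circleMap c R θ))) := by
    intro θ
    have he : Complex.exp (-(l * θ * Complex.I)) = (Complex.exp (θ * Complex.I) ^ l)⁻¹ := by
      rw [← Complex.exp_nat_mul, ← Complex.exp_neg]
      ring_nf
    have hθ : Complex.exp (θ * Complex.I) ≠ 0 := Complex.exp_ne_zero _
    rw [smul_smul, smul_smul, he]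
    simp only [deriv_circleMap, circleMap, zero_add, add_sub_cancel_left]
    congr 1
    have hI : Complex.I ≠ 0 := Complex.I_ne_zero
    field_simp
    ring
  simp_rw [e]
  rw [integral_angleMeasure, intervalIntegral.integral_smul]
  rw [circleIntegral] at h
  rw [h, ← Complex.coe_smul, ← Complex.coe_smul, smul_smul, smul_smul]
  congr 1
  push_cast
  field_simp [Complex.I_ne_zero]

end Circle

/-! ### Coefficients of a holomorphic function of one variable on shifted circles -/

/-- The product of a Fourier mode in the angle and a Hermite polynomial. -/
noncomputable def waveHermite (k : ℕ × ℕ) (ω : ℝ × ℝ) : ℂ :=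
  Complex.exp (k.1 * ω.1 * Complex.I) * hermiteFun k.2 ω.2

/-- The measure on pairs of an angle and a Gaussian variable. -/
noncomputable abbrev angleGaussian : Measure (ℝ × ℝ) := angleMeasure.prod (gaussianReal 0 1)

lemma continuous_waveHermite (k : ℕ × ℕ) : Continuous (waveHermite k) := by
  have := continuous_hermiteFun k.2
  unfold waveHermite
  fun_prop

lemma norm_waveHermite (k : ℕ × ℕ) (ω : ℝ × ℝ) : ‖waveHermite k ω‖ = ‖hermiteFun k.2 ω.2‖ := by
  have : (k.1 * ω.1 * Complex.I : ℂ) = ((k.1 * ω.1 : ℝ) : ℂ) * Complex.I := by push_cast; rfl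
  rw [waveHermite, norm_mul, this, Complex.norm_exp_ofReal_mul_I, one_mul, Complex.norm_real]

lemma measurePreserving_snd_angleGaussian :
    MeasurePreserving (Prod.snd : ℝ × ℝ → ℝ) angleGaussian (gaussianReal 0 1) :=
  measurePreserving_snd

lemma memLp_waveHermite (k : ℕ × ℕ) : MemLp (waveHermite k) 2 angleGaussian := by
  refine ((memLp_hermiteFun k.2).comp_measurePreserving
    measurePreserving_snd_angleGaussian).congr_norm
    (continuous_waveHermite k).aestronglyMeasurable (ae_of_all _ fun ω => ?_)
  rw [norm_waveHermite, Function.comp_apply]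

lemma integral_conj_waveHermite_mul (k k' : ℕ × ℕ) :
    ∫ ω, (starRingEnd ℂ) (waveHermite k ω) * waveHermite k' ω ∂angleGaussian =
      if k = k' then 1 else 0 := by
  have e : ∀ ω : ℝ × ℝ, (starRingEnd ℂ) (waveHermite k ω) * waveHermite k' ω =
      Complex.exp (((k'.1 - k.1 : ℤ) : ℂ) * ω.1 * Complex.I) *
        ((hermiteFun k.2 ω.2 * hermiteFun k'.2 ω.2 : ℝ) : ℂ) := by
    intro ω
    simp only [waveHermite, map_mul, Complex.conj_ofReal, ← Complex.exp_conj, Complex.conj_I,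
      map_natCast]
    push_cast
    rw [mul_mul_mul_comm, ← Complex.exp_add]
    ring_nf
  simp_rw [e]
  rw [integral_prod_mul (μ := angleMeasure) (ν := gaussianReal 0 1)
    (fun θ : ℝ => Complex.exp (((k'.1 - k.1 : ℤ) : ℂ) * θ * Complex.I))
    (fun y : ℝ => ((hermiteFun k.2 y * hermiteFun k'.2 y : ℝ) : ℂ)),
    integral_exp_mul_I, integral_complex_ofReal, integral_hermiteFun_mul_hermiteFun]
  have h1 : ((k'.1 - k.1 : ℤ) = 0) ↔ k.1 = k'.1 := by omega
  simp only [h1, Prod.ext_iff]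
  by_cases a : k.1 = k'.1 <;> by_cases b : k.2 = k'.2 <;> simp [a, b]

section Strip

variable {X : Type*} [NormedAddCommGroup X] [NormedSpace ℂ X]
  {f : ℂ → X} {r κ : ℝ} {g : ℝ → ℝ}

lemma isOpen_abs_im_lt (r : ℝ) : IsOpen {w : ℂ | |w.im| < r} :=
  isOpen_lt (Complex.continuous_im.abs) continuous_const

lemma abs_im_add_mul_exp_lt (hκ : 0 ≤ κ) (hκr : κ < r) (y θ : ℝ) :
    |((y : ℂ) + κ * Complex.exp (θ * Complex.I)).im| < r := by
  have h : ((y : ℂ) + κ * Complex.exp (θ * Complex.I)).im =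
      ((κ : ℂ) * Complex.exp (θ * Complex.I)).im := by simp
  rw [h]
  refine (Complex.abs_im_le_norm _).trans_lt ?_
  rwa [norm_mul, Complex.norm_exp_ofReal_mul_I, mul_one, Complex.norm_real, Real.norm_eq_abs,
    abs_of_nonneg hκ]

lemma diffContOnCl_ball_of_strip (hκr : κ < r) (hf : DifferentiableOn ℂ f {w | |w.im| < r})
    (y : ℝ) : DiffContOnCl ℂ f (Metric.ball (y : ℂ) κ) := by
  refine (hf.mono fun w hw => ?_).diffContOnCl_ball (U := {w : ℂ | |w.im| < r}) (c := (y : ℂ))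
    (R := κ) ?_
  · exact hw
  · intro w hw
    have h : w.im = (w - y).im := by simp
    rw [Set.mem_ofPred_eq, h]
    refine (Complex.abs_im_le_norm _).trans_lt (lt_of_le_of_lt ?_ hκr)
    simpa [dist_eq_norm] using hw

variable [CompleteSpace X]

lemma analyticOnNhd_iteratedDeriv_strip (hf : DifferentiableOn ℂ f {w | |w.im| < r}) (l : ℕ) :
    AnalyticOnNhd ℂ (iteratedDeriv l f) {w | |w.im| < r} := by
  rw [iteratedDeriv_eq_iterate]
  exact (hf.analyticOnNhd (isOpen_abs_im_lt r)).iterated_deriv l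

lemma hasDerivAt_iteratedDeriv_ofReal (hr : 0 < r) (hf : DifferentiableOn ℂ f {w | |w.im| < r})
    (l : ℕ) (x : ℝ) :
    HasDerivAt (fun x : ℝ => iteratedDeriv l f x) (iteratedDeriv (l + 1) f x) x := by
  have h := (analyticOnNhd_iteratedDeriv_strip hf l (x : ℂ) (by simpa using hr)).differentiableAt
  rw [iteratedDeriv_succ]
  simpa using! h.hasDerivAt.scomp x Complex.ofRealCLM.hasDerivAt

lemma integrable_hermiteFun_smul_iteratedDeriv (hκ : 0 < κ) (hκr : κ < r)
    (hf : DifferentiableOn ℂ f {w | |w.im| < r}) (hg : MemLp g 2 (gaussianReal 0 1))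
    (hfg : ∀ (y : ℝ) (z : ℂ), ‖z‖ < r → ‖f (y + z)‖ ≤ g y) (m l : ℕ) :
    Integrable (fun y : ℝ => hermiteFun m y • iteratedDeriv l f y) (gaussianReal 0 1) := by
  have hi : Integrable (fun y => ‖hermiteFun m y‖ * (l ! * g y / κ ^ l)) (gaussianReal 0 1) :=
    (memLp_hermiteFun m).norm.integrable_mul ((hg.const_mul (l ! : ℝ)).mul_const (κ ^ l)⁻¹)
  have hc : Continuous fun y : ℝ => iteratedDeriv l f y := continuous_iff_continuousAt.2 fun x =>
    (hasDerivAt_iteratedDeriv_ofReal (hκ.trans hκr) hf l x).continuousAt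
  refine hi.mono' ((continuous_hermiteFun m).smul hc).aestronglyMeasurable
    (ae_of_all _ fun y => ?_)
  rw [norm_smul]
  refine mul_le_mul_of_nonneg_left ?_ (norm_nonneg _)
  refine Complex.norm_iteratedDeriv_le_of_forall_mem_sphere_norm_le l hκ
    (diffContOnCl_ball_of_strip hκr hf y) fun z hz => ?_
  have := hfg y (z - y) (by rw [← dist_eq_norm, Metric.mem_sphere.1 hz]; exact hκr)
  simpa using this

lemma integral_hermiteFun_smul_iteratedDeriv (hκ : 0 < κ) (hκr : κ < r)
    (hf : DifferentiableOn ℂ f {w | |w.im| < r}) (hg : MemLp g 2 (gaussianReal 0 1))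
    (hfg : ∀ (y : ℝ) (z : ℂ), ‖z‖ < r → ‖f (y + z)‖ ≤ g y) (m l : ℕ) :
    √(m ! : ℝ) • ∫ y : ℝ, hermiteFun m y • iteratedDeriv l f y ∂gaussianReal 0 1 =
      √((m + l)! : ℝ) • ∫ y : ℝ, hermiteFun (m + l) y • f y ∂gaussianReal 0 1 := by
  induction l generalizing m with
  | zero => simp
  | succ l ih =>
    have hI := integrable_hermiteFun_smul_iteratedDeriv hκ hκr hf hg hfg
    rw [integral_hermiteFun_smul_deriv m
      (hasDerivAt_iteratedDeriv_ofReal (hκ.trans hκr) hf l) (hI m l) (hI (m + 1) l)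
      (hI m (l + 1)), smul_smul, mul_comm, ← sqrt_factorial_succ, ih (m + 1)]
    rw [show m + 1 + l = m + (l + 1) by ring]

/-- The factor between the `H_{m+l}`-coefficient of a function and the `(l, m)`-coefficient of its
shifts over the circle of radius `κ`. -/
noncomputable def shiftFactor (κ : ℝ) (k : ℕ × ℕ) : ℝ :=
  κ ^ k.1 / k.1 ! * (√((k.2 + k.1)! : ℝ) / √(k.2 ! : ℝ))

lemma shiftFactor_sq (κ : ℝ) (k : ℕ × ℕ) :
    shiftFactor κ k ^ 2 = (k.2 + k.1).choose k.1 * κ ^ (2 * k.1) / k.1 ! := by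
  have h : ((k.2 + k.1).choose k.1 : ℝ) * k.1 ! * k.2 ! = (k.2 + k.1)! := by
    have := Nat.choose_mul_factorial_mul_factorial (Nat.le_add_left k.1 k.2)
    rw [Nat.add_sub_cancel] at this
    exact_mod_cast this
  rw [shiftFactor, mul_pow, div_pow, div_pow, Real.sq_sqrt (by positivity),
    Real.sq_sqrt (by positivity), ← h]
  have h1 : (k.1 ! : ℝ) ≠ 0 := by positivity
  have h2 : (k.2 ! : ℝ) ≠ 0 := by positivity
  field_simp
  ring

/-- The coefficient of `(θ, y) ↦ f (y + κ e^{iθ})` with respect to `e^{ilθ} H_m(y)` is a multiple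
of the `H_{m+l}`-coefficient of `f`: averaging over the circle yields the `l`-th derivative, and
`l` integrations by parts remove it. -/
lemma integral_conj_waveHermite_smul (hκ : 0 < κ) (hκr : κ < r)
    (hf : DifferentiableOn ℂ f {w | |w.im| < r}) (hg : MemLp g 2 (gaussianReal 0 1))
    (hfg : ∀ (y : ℝ) (z : ℂ), ‖z‖ < r → ‖f (y + z)‖ ≤ g y) (k : ℕ × ℕ) :
    ∫ ω, (starRingEnd ℂ) (waveHermite k ω) • f (ω.2 + κ * Complex.exp (ω.1 * Complex.I))
        ∂angleGaussian =
      ∫ ω, ((shiftFactor κ k * hermiteFun (k.2 + k.1) ω.2 : ℝ) : ℂ) • f ω.2 ∂angleGaussian := by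
  have hc : Continuous fun ω : ℝ × ℝ => f (ω.2 + κ * Complex.exp (ω.1 * Complex.I)) :=
    hf.continuousOn.comp_continuous (by fun_prop)
      fun ω => abs_im_add_mul_exp_lt hκ.le hκr ω.2 ω.1
  have hI : Integrable (fun ω : ℝ × ℝ => (starRingEnd ℂ) (waveHermite k ω) •
      f (ω.2 + κ * Complex.exp (ω.1 * Complex.I))) angleGaussian := by
    have hi : Integrable (fun y => ‖hermiteFun k.2 y‖ * g y) (gaussianReal 0 1) :=
      (memLp_hermiteFun k.2).norm.integrable_mul hg
    refine (hi.comp_snd angleMeasure).mono' ?_ (ae_of_all _ fun ω => ?_)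
    · exact ((Complex.continuous_conj.comp (continuous_waveHermite k)).smul hc).aestronglyMeasurable
    · rw [norm_smul, RCLike.norm_conj, norm_waveHermite]
      refine mul_le_mul_of_nonneg_left (hfg _ _ ?_) (norm_nonneg _)
      rwa [norm_mul, Complex.norm_exp_ofReal_mul_I, mul_one, Complex.norm_real, Real.norm_eq_abs,
        abs_of_nonneg hκ.le]
  rw [integral_prod_symm _ hI]
  have inner : ∀ y : ℝ, ∫ θ : ℝ, (starRingEnd ℂ) (waveHermite k (θ, y)) •
      f (y + κ * Complex.exp (θ * Complex.I)) ∂angleMeasure =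
        (κ ^ k.1 / k.1 ! : ℝ) • (hermiteFun k.2 y • iteratedDeriv k.1 f y) := by
    intro y
    rw [smul_comm, ← integral_exp_smul_circle hκ (diffContOnCl_ball_of_strip hκr hf y),
      ← integral_smul]
    refine integral_congr_ae (ae_of_all _ fun θ => ?_)
    simp only [waveHermite, map_mul, Complex.conj_ofReal, ← Complex.exp_conj, Complex.conj_I,
      map_natCast, mul_neg]
    rw [mul_comm, mul_smul, Complex.coe_smul]
  simp only [inner]
  rw [integral_smul]
  have key := integral_hermiteFun_smul_iteratedDeriv hκ hκr hf hg hfg k.2 k.1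
  have hm : √(k.2 ! : ℝ) ≠ 0 := by positivity
  have hs : ∫ ω : ℝ × ℝ, ((shiftFactor κ k * hermiteFun (k.2 + k.1) ω.2 : ℝ) : ℂ) • f ω.2
      ∂angleGaussian = shiftFactor κ k • ∫ y : ℝ, hermiteFun (k.2 + k.1) y • f y
        ∂gaussianReal 0 1 := by
    rw [integral_fun_snd
      (fun y : ℝ => ((shiftFactor κ k * hermiteFun (k.2 + k.1) y : ℝ) : ℂ) • f y),
      probReal_univ, one_smul, ← integral_smul]
    refine integral_congr_ae (ae_of_all _ fun y => ?_)
    simp only [Complex.coe_smul, mul_smul]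
  rw [hs, shiftFactor, mul_smul, div_eq_inv_mul (√((k.2 + k.1)! : ℝ)), mul_smul (√(k.2 ! : ℝ))⁻¹,
    ← key, inv_smul_smul₀ hm]

end Strip

/-! ### Products of probability spaces -/

section Product

variable {ι α : Type*} [Fintype ι] [MeasurableSpace α] {m : Measure α} [IsProbabilityMeasure m]

lemma memLp_prod_pi {f : ι → α → ℂ} (hf : ∀ i, MemLp (f i) 2 m) :
    MemLp (fun ω : ι → α => ∏ i, f i (ω i)) 2 (Measure.pi fun _ => m) := by
  have hm : AEStronglyMeasurable (fun ω : ι → α => ∏ i, f i (ω i)) (Measure.pi fun _ => m) := by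
    refine Finset.aestronglyMeasurable_fun_prod _ fun i _ => ?_
    exact (hf i).1.comp_measurePreserving (measurePreserving_eval (fun _ => m) i)
  rw [memLp_two_iff_integrable_sq_norm hm]
  simp_rw [norm_prod, ← Finset.prod_pow]
  exact Integrable.fintype_prod fun i => (memLp_two_iff_integrable_sq_norm (hf i).1).1 (hf i)

/-- Tensor products of an orthonormal system are orthonormal. -/
lemma integral_conj_prod_mul_prod {K : Type*} [DecidableEq K] {h : K → α → ℂ}
    (hh : ∀ k k', ∫ x, (starRingEnd ℂ) (h k x) * h k' x ∂m = if k = k' then 1 else 0)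
    (k k' : ι → K) :
    ∫ ω : ι → α, (starRingEnd ℂ) (∏ i, h (k i) (ω i)) * ∏ i, h (k' i) (ω i)
      ∂(Measure.pi fun _ => m) = if k = k' then 1 else 0 := by
  simp_rw [map_prod, ← Finset.prod_mul_distrib]
  rw [integral_fintype_prod_eq_prod
    (f := fun i x => (starRingEnd ℂ) (h (k i) x) * h (k' i) x)]
  simp_rw [hh, Finset.prod_boole]
  simp [funext_iff]

variable [DecidableEq ι]

/-- Resampling one coordinate does not change the law of a product measure. -/
lemma measurePreserving_update_pi (j : ι) :
    MeasurePreserving (fun q : (ι → α) × α => Function.update q.1 j q.2)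
      ((Measure.pi fun _ : ι => m).prod m) (Measure.pi fun _ : ι => m) := by
  have hmeas : Measurable fun q : (ι → α) × α => Function.update q.1 j q.2 := by
    refine measurable_pi_lambda _ fun i => ?_
    by_cases h : i = j
    · subst h
      simpa using measurable_snd
    · simpa [Function.update_of_ne h] using! (measurable_pi_apply i).comp measurable_fst
  refine ⟨hmeas, (Measure.pi_eq fun s hs => ?_).symm⟩
  rw [Measure.map_apply hmeas (MeasurableSet.univ_pi hs)]
  have hpre : (fun q : (ι → α) × α => Function.update q.1 j q.2) ⁻¹' (Set.univ.pi s) =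
      (Set.univ.pi (Function.update s j Set.univ)) ×ˢ s j := by
    ext q
    simp only [Set.mem_preimage, Set.mem_pi, Set.mem_univ, true_implies, Set.mem_prod]
    constructor
    · intro h
      refine ⟨fun i => ?_, by simpa using h j⟩
      by_cases hi : i = j
      · subst hi
        simp
      · simpa [hi] using h i
    · rintro ⟨h, hj⟩ i
      by_cases hi : i = j
      · subst hi
        simpa using hj
      · simpa [hi] using h i
  rw [hpre, Measure.prod_prod, Measure.pi_pi,
    ← Finset.mul_prod_erase Finset.univ _ (Finset.mem_univ j),
    ← Finset.mul_prod_erase Finset.univ (fun i => m (s i)) (Finset.mem_univ j)]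
  rw [Function.update_self, measure_univ, one_mul, mul_comm]
  congr 1
  refine Finset.prod_congr rfl fun i hi => ?_
  rw [Function.update_of_ne (Finset.ne_of_mem_erase hi)]

lemma integral_eq_integral_update {X : Type*} [NormedAddCommGroup X] [NormedSpace ℝ X]
    (j : ι) {F : (ι → α) → X} (hF : Integrable F (Measure.pi fun _ => m)) :
    ∫ ω, F ω ∂(Measure.pi fun _ => m) =
      ∫ ω, ∫ x, F (Function.update ω j x) ∂m ∂(Measure.pi fun _ => m) := by
  have mp := measurePreserving_update_pi (m := m) j
  have hF' : AEStronglyMeasurable F (Measure.map (fun q : (ι → α) × α => Function.update q.1 j q.2)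
      ((Measure.pi fun _ : ι => m).prod m)) := by
    rw [mp.map_eq]
    exact hF.1
  have h1 : ∫ q, F (Function.update q.1 j q.2) ∂((Measure.pi fun _ : ι => m).prod m) =
      ∫ ω, F ω ∂(Measure.pi fun _ => m) := by
    rw [← integral_map mp.aemeasurable hF', mp.map_eq]
  rw [← h1]
  exact integral_prod _ ((mp.integrable_comp hF.1).2 hF)

lemma memLp_update_ae {E : Type*} [NormedAddCommGroup E] (j : ι) {f : (ι → α) → E}
    (hf : MemLp f 2 (Measure.pi fun _ => m)) :
    ∀ᵐ ω ∂(Measure.pi fun _ => m), MemLp (fun x => f (Function.update ω j x)) 2 m := by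
  have h := hf.comp_measurePreserving (measurePreserving_update_pi (m := m) j)
  have h2 := (memLp_two_iff_integrable_sq_norm h.1).1 h
  filter_upwards [h2.prod_right_ae, h.1.prodMk_left] with ω h3 h4
  exact (memLp_two_iff_integrable_sq_norm h4).2 h3

end Product

/-! ### Coefficients of a holomorphic function on shifted tori -/

section Torus

variable {X : Type*} [NormedAddCommGroup X] [InnerProductSpace ℂ X]
  {N : ℕ} {ϱ κ : Fin N → ℝ} {U : (Fin N → ℂ) → X} {Φ : (Fin N → ℝ) → ℝ}

instance (N : ℕ) : IsProbabilityMeasure (gammaFin N) := by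
  unfold gammaFin
  infer_instance

/-- The product measure on `N` pairs of an angle and a Gaussian variable. -/
noncomputable abbrev torusGaussian (N : ℕ) : Measure (Fin N → ℝ × ℝ) :=
  Measure.pi fun _ => angleGaussian

/-- The Gaussian coordinates of a point. -/
def realPart (ω : Fin N → ℝ × ℝ) : Fin N → ℝ := fun j => (ω j).2

lemma measurePreserving_realPart :
    MeasurePreserving (realPart : (Fin N → ℝ × ℝ) → Fin N → ℝ) (torusGaussian N) (gammaFin N) :=
  measurePreserving_pi _ _ fun _ => measurePreserving_snd_angleGaussian

/-- The shift of the Gaussian coordinates along the torus of radii `κ`, in the coordinates outside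
`S`. -/
noncomputable def partialShift (κ : Fin N → ℝ) (S : Finset (Fin N)) (ω : Fin N → ℝ × ℝ) :
    Fin N → ℂ :=
  fun j => if j ∈ S then 0 else κ j * Complex.exp ((ω j).1 * Complex.I)

/-- The kernel that takes the coefficient for `waveHermite` in the coordinates outside `S`, and the
corresponding multiple of a Hermite coefficient in the coordinates of `S`. -/
noncomputable def partialKernel (κ : Fin N → ℝ) (k : Fin N → ℕ × ℕ) (S : Finset (Fin N))
    (j : Fin N) (x : ℝ × ℝ) : ℂ :=
  if j ∈ S then ((shiftFactor (κ j) (k j) * hermiteFun ((k j).2 + (k j).1) x.2 : ℝ) : ℂ)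
  else (starRingEnd ℂ) (waveHermite (k j) x)

lemma continuous_partialKernel (k : Fin N → ℕ × ℕ) (S : Finset (Fin N)) (j : Fin N) :
    Continuous (partialKernel κ k S j) := by
  have h1 := continuous_hermiteFun ((k j).2 + (k j).1)
  have h2 := Complex.continuous_conj.comp (continuous_waveHermite (k j))
  unfold partialKernel
  by_cases h : j ∈ S
  · simp only [h, if_true]
    fun_prop
  · simp only [h, if_false]
    exact h2

lemma memLp_partialKernel (k : Fin N → ℕ × ℕ) (S : Finset (Fin N)) (j : Fin N) :
    MemLp (partialKernel κ k S j) 2 angleGaussian := by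
  by_cases h : j ∈ S
  · refine (((memLp_hermiteFun ((k j).2 + (k j).1)).const_mul
      (shiftFactor (κ j) (k j))).comp_measurePreserving
      measurePreserving_snd_angleGaussian).congr_norm
      (continuous_partialKernel k S j).aestronglyMeasurable (ae_of_all _ fun ω => ?_)
    simp [partialKernel, h]
  · refine (memLp_waveHermite (k j)).congr_norm
      (continuous_partialKernel k S j).aestronglyMeasurable (ae_of_all _ fun ω => ?_)
    simp [partialKernel, h]

lemma norm_mul_exp_lt {κ r : ℝ} (hκ : 0 < κ) (hκr : κ < r) (θ : ℝ) :
    ‖(κ : ℂ) * Complex.exp (θ * Complex.I)‖ < r := by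
  rwa [norm_mul, Complex.norm_exp_ofReal_mul_I, mul_one, Complex.norm_real, Real.norm_eq_abs,
    abs_of_pos hκ]

lemma partialShift_mem_polydisc (hκ : ∀ j, 0 < κ j) (hκϱ : ∀ j, κ j < ϱ j) (S : Finset (Fin N))
    (ω : Fin N → ℝ × ℝ) : partialShift κ S ω ∈ polydisc ϱ := by
  intro j
  simp only [partialShift]
  split_ifs
  · simpa using (hκ j).trans (hκϱ j)
  · exact norm_mul_exp_lt (hκ j) (hκϱ j) _

lemma toComplex_add_mem_strip {z : Fin N → ℂ} (hz : z ∈ polydisc ϱ) (y : Fin N → ℝ) :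
    toComplex y + z ∈ strip ϱ := fun j => by
  simpa [toComplex] using (Complex.abs_im_le_norm (z j)).trans_lt (hz j)

lemma continuous_partialShift (S : Finset (Fin N)) : Continuous (partialShift κ S) := by
  refine continuous_pi fun j => ?_
  by_cases h : j ∈ S
  · simp only [partialShift, h, if_true]
    fun_prop
  · simp only [partialShift, h, if_false]
    fun_prop

lemma continuous_realPart : Continuous (realPart : (Fin N → ℝ × ℝ) → Fin N → ℝ) :=
  continuous_pi fun j => continuous_snd.comp (continuous_apply j)

lemma continuous_toComplex : Continuous (toComplex : (Fin N → ℝ) → Fin N → ℂ) :=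
  continuous_pi fun j => Complex.continuous_ofReal.comp (continuous_apply j)

lemma continuous_comp_partialShift (hκ : ∀ j, 0 < κ j) (hκϱ : ∀ j, κ j < ϱ j)
    (hU : DifferentiableOn ℂ U (strip ϱ)) (S : Finset (Fin N)) :
    Continuous fun ω => U (toComplex (realPart ω) + partialShift κ S ω) :=
  hU.continuousOn.comp_continuous
    ((continuous_toComplex.comp continuous_realPart).add (continuous_partialShift S))
    fun ω => toComplex_add_mem_strip (partialShift_mem_polydisc hκ hκϱ S ω) _

lemma memLp_comp_partialShift (hκ : ∀ j, 0 < κ j) (hκϱ : ∀ j, κ j < ϱ j)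
    (hU : DifferentiableOn ℂ U (strip ϱ)) (hΦ : MemLp Φ 2 (gammaFin N))
    (hUΦ : ∀ z ∈ polydisc ϱ, ∀ y : Fin N → ℝ, ‖U (toComplex y + z)‖ ≤ Φ y)
    (S : Finset (Fin N)) :
    MemLp (fun ω => U (toComplex (realPart ω) + partialShift κ S ω)) 2 (torusGaussian N) :=
  (hΦ.comp_measurePreserving measurePreserving_realPart).mono'
    (continuous_comp_partialShift hκ hκϱ hU S).aestronglyMeasurable
    (ae_of_all _ fun ω => hUΦ _ (partialShift_mem_polydisc hκ hκϱ S ω) _)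

lemma integrable_partialKernel_smul (hκ : ∀ j, 0 < κ j) (hκϱ : ∀ j, κ j < ϱ j)
    (hU : DifferentiableOn ℂ U (strip ϱ)) (hΦ : MemLp Φ 2 (gammaFin N))
    (hUΦ : ∀ z ∈ polydisc ϱ, ∀ y : Fin N → ℝ, ‖U (toComplex y + z)‖ ≤ Φ y)
    (k : Fin N → ℕ × ℕ) (S : Finset (Fin N)) :
    Integrable (fun ω => (∏ j, partialKernel κ k S j (ω j)) •
      U (toComplex (realPart ω) + partialShift κ S ω)) (torusGaussian N) :=
  memLp_one_iff_integrable.1 <| (memLp_comp_partialShift hκ hκϱ hU hΦ hUΦ S).smul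
    (memLp_prod_pi fun j => memLp_partialKernel k S j)

/-- Replacing the `waveHermite` coefficient by a Hermite coefficient in one coordinate. -/
lemma integral_partialKernel_insert [CompleteSpace X] (hκ : ∀ j, 0 < κ j) (hκϱ : ∀ j, κ j < ϱ j)
    (hU : DifferentiableOn ℂ U (strip ϱ)) (hΦ : MemLp Φ 2 (gammaFin N))
    (hUΦ : ∀ z ∈ polydisc ϱ, ∀ y : Fin N → ℝ, ‖U (toComplex y + z)‖ ≤ Φ y)
    (k : Fin N → ℕ × ℕ) (S : Finset (Fin N)) {j : Fin N} (hj : j ∉ S) :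
    ∫ ω, (∏ i, partialKernel κ k S i (ω i)) •
        U (toComplex (realPart ω) + partialShift κ S ω) ∂torusGaussian N =
      ∫ ω, (∏ i, partialKernel κ k (insert j S) i (ω i)) •
        U (toComplex (realPart ω) + partialShift κ (insert j S) ω) ∂torusGaussian N := by
  rw [integral_eq_integral_update j (integrable_partialKernel_smul hκ hκϱ hU hΦ hUΦ k S),
    integral_eq_integral_update j (integrable_partialKernel_smul hκ hκϱ hU hΦ hUΦ k (insert j S))]
  refine integral_congr_ae ?_
  filter_upwards [measurePreserving_realPart.quasiMeasurePreserving.ae (memLp_update_ae j hΦ)]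
    with ω hω
  set C : ℂ := ∏ i ∈ Finset.univ.erase j, partialKernel κ k S i (ω i) with hC
  set P : Fin N → ℂ := toComplex (realPart ω) + partialShift κ S ω with hP
  have hprod : ∀ T, (∀ i, i ≠ j → (i ∈ T ↔ i ∈ S)) → ∀ x : ℝ × ℝ,
      ∏ i, partialKernel κ k T i (Function.update ω j x i) = partialKernel κ k T j x * C := by
    intro T hT x
    rw [← Finset.mul_prod_erase Finset.univ _ (Finset.mem_univ j), Function.update_self]
    congr 1
    refine Finset.prod_congr rfl fun i hi => ?_
    have hij := Finset.ne_of_mem_erase hi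
    simp only [partialKernel, hT i hij, Function.update_of_ne hij]
  have hpt : ∀ T, (∀ i, i ≠ j → (i ∈ T ↔ i ∈ S)) → ∀ x : ℝ × ℝ,
      toComplex (realPart (Function.update ω j x)) + partialShift κ T (Function.update ω j x) =
        Function.update P j (x.2 + if j ∈ T then 0 else κ j * Complex.exp (x.1 * Complex.I)) := by
    intro T hT x
    ext i
    by_cases hij : i = j
    · subst hij
      simp [toComplex, realPart, partialShift]
    · simp [hP, toComplex, realPart, partialShift, hT i hij, hij]
  have hins : ∀ i, i ≠ j → (i ∈ insert j S ↔ i ∈ S) := fun i hi => by simp [hi]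
  simp only [hprod S (fun _ _ => Iff.rfl), hprod _ hins, hpt S (fun _ _ => Iff.rfl), hpt _ hins,
    mul_smul]
  simp only [partialKernel, hj, Finset.mem_insert_self, if_true, if_false, add_zero]
  have hupd : ∀ (y : ℝ) (z : ℂ), Function.update P j (y + z) =
      toComplex (Function.update (realPart ω) j y) +
        Function.update (partialShift κ S ω) j z := by
    intro y z
    ext i
    by_cases hij : i = j
    · subst hij
      simp [toComplex]
    · simp [hP, toComplex, hij]
  have hpoly : ∀ z : ℂ, ‖z‖ < ϱ j → Function.update (partialShift κ S ω) j z ∈ polydisc ϱ := by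
    intro z hz i
    by_cases hij : i = j
    · subst hij
      simpa using hz
    · simpa [hij] using partialShift_mem_polydisc hκ hκϱ S ω i
  refine integral_conj_waveHermite_smul (f := fun w => C • U (Function.update P j w))
    (g := fun t => ‖C‖ * Φ (Function.update (realPart ω) j t)) (hκ j) (hκϱ j) ?_
    (hω.const_mul _) ?_ (k j)
  · refine DifferentiableOn.const_smul (hU.comp ?_ ?_) C
    · refine (differentiable_pi.2 fun i => ?_).differentiableOn
      by_cases hij : i = j
      · subst hij
        simp
      · simp [hij]
    · intro w hw i
      by_cases hij : i = j
      · subst hij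
        simpa using hw
      · simpa [hij, hP] using toComplex_add_mem_strip (partialShift_mem_polydisc hκ hκϱ S ω)
          (realPart ω) i
  · intro y z hz
    rw [norm_smul, hupd]
    exact mul_le_mul_of_nonneg_left (hUΦ _ (hpoly z hz) _) (norm_nonneg _)

/-- The coefficients of `(θ, y) ↦ U (y + κ e^{iθ})` are multiples of the Hermite coefficients of
`U`. -/
lemma integral_conj_prod_waveHermite_smul [CompleteSpace X] (hκ : ∀ j, 0 < κ j)
    (hκϱ : ∀ j, κ j < ϱ j)
    (hU : DifferentiableOn ℂ U (strip ϱ)) (hΦ : MemLp Φ 2 (gammaFin N))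
    (hUΦ : ∀ z ∈ polydisc ϱ, ∀ y : Fin N → ℝ, ‖U (toComplex y + z)‖ ≤ Φ y)
    (k : Fin N → ℕ × ℕ) :
    ∫ ω, (starRingEnd ℂ) (∏ j, waveHermite (k j) (ω j)) •
        U (toComplex (realPart ω) + partialShift κ ∅ ω) ∂torusGaussian N =
      (∏ j, shiftFactor (κ j) (k j)) •
        ∫ y, (∏ j, hermiteFun ((k j).2 + (k j).1) (y j)) • U (toComplex y) ∂gammaFin N := by
  have hall : ∀ S : Finset (Fin N),
      ∫ ω, (∏ i, partialKernel κ k ∅ i (ω i)) •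
        U (toComplex (realPart ω) + partialShift κ ∅ ω) ∂torusGaussian N =
      ∫ ω, (∏ i, partialKernel κ k S i (ω i)) •
        U (toComplex (realPart ω) + partialShift κ S ω) ∂torusGaussian N := by
    intro S
    induction S using Finset.induction_on with
    | empty => rfl
    | insert j S hj ih =>
      rw [ih, integral_partialKernel_insert hκ hκϱ hU hΦ hUΦ k S hj]
  have h := hall Finset.univ
  simp only [partialKernel, Finset.notMem_empty, if_false, Finset.mem_univ, if_true] at h
  have h0 : ∀ ω : Fin N → ℝ × ℝ, partialShift κ Finset.univ ω = 0 := fun ω => by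
    ext j
    simp [partialShift]
  have hc : Continuous fun y : Fin N → ℝ => (∏ j, hermiteFun ((k j).2 + (k j).1) (y j)) •
      U (toComplex y) := by
    refine (continuous_finsetProd _ fun j _ =>
      (continuous_hermiteFun _).comp (continuous_apply j)).smul
      (hU.continuousOn.comp_continuous continuous_toComplex fun y j => ?_)
    simpa [toComplex] using (hκ j).trans (hκϱ j)
  simp only [map_prod]
  rw [h, ← (measurePreserving_realPart (N := N)).map_eq,
    integral_map measurePreserving_realPart.aemeasurable hc.aestronglyMeasurable, ← integral_smul]
  refine integral_congr_ae (ae_of_all _ fun ω => ?_)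
  simp only [h0, add_zero]
  rw [smul_smul, ← Finset.prod_mul_distrib, ← Complex.ofReal_prod, Complex.coe_smul]
  rfl

end Torus

/-! ### Expansions of vector-valued functions in scalar orthonormal systems -/

section Orthonormal

variable {Ω ι X : Type*} [MeasurableSpace Ω] {μ : Measure Ω} [DecidableEq ι]
  [NormedAddCommGroup X] [InnerProductSpace ℂ X]

lemma memLp_smul_const {f : Ω → ℂ} (hf : MemLp f 2 μ) (x : X) : MemLp (fun ω => f ω • x) 2 μ :=
  (ContinuousLinearMap.toSpanSingleton ℂ x).comp_memLp' hf

lemma integrable_conj_smul {f : Ω → ℂ} (hf : MemLp f 2 μ) {F : Ω → X} (hF : MemLp F 2 μ) :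
    Integrable (fun ω => (starRingEnd ℂ) (f ω) • F ω) μ :=
  memLp_one_iff_integrable.1 (hF.smul hf.star)

lemma inner_toLp_smul_const {f g : Ω → ℂ} (hf : MemLp f 2 μ) (hg : MemLp g 2 μ) (x y : X) :
    inner ℂ ((memLp_smul_const hf x).toLp) ((memLp_smul_const hg y).toLp) =
      (∫ ω, (starRingEnd ℂ) (f ω) * g ω ∂μ) * inner ℂ x y := by
  rw [L2.inner_def, ← integral_mul_const]
  refine integral_congr_ae ?_
  filter_upwards [(memLp_smul_const hf x).coeFn_toLp, (memLp_smul_const hg y).coeFn_toLp]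
    with ω h1 h2
  rw [h1, h2, inner_smul_left, inner_smul_right, mul_assoc]

lemma inner_toLp_smul_const_left [CompleteSpace X] {f : Ω → ℂ} (hf : MemLp f 2 μ) {F : Ω → X}
    (hF : MemLp F 2 μ) (x : X) :
    inner ℂ ((memLp_smul_const hf x).toLp) hF.toLp =
      inner ℂ x (∫ ω, (starRingEnd ℂ) (f ω) • F ω ∂μ) := by
  rw [L2.inner_def, ← integral_inner (integrable_conj_smul hf hF)]
  refine integral_congr_ae ?_
  filter_upwards [(memLp_smul_const hf x).coeFn_toLp, hF.coeFn_toLp] with ω h1 h2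
  rw [h1, h2, inner_smul_left, inner_smul_right]

/-- A system of scalar functions that is orthonormal in `L²(μ)`. -/
structure IsOrthonormalSystem (μ : Measure Ω) (h : ι → Ω → ℂ) : Prop where
  memLp : ∀ i, MemLp (h i) 2 μ
  integral_conj_mul : ∀ i j, ∫ ω, (starRingEnd ℂ) (h i ω) * h j ω ∂μ = if i = j then 1 else 0

/-- The coefficient of a vector-valued function with respect to a scalar function, which enters
conjugated. -/
noncomputable def coeffWith (μ : Measure Ω) (f : Ω → ℂ) (F : Ω → X) : X :=
  ∫ ω, (starRingEnd ℂ) (f ω) • F ω ∂μ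

variable {h : ι → Ω → ℂ}

namespace IsOrthonormalSystem

/-- The isometric embedding `x ↦ h i • x` of `X` into `L²(μ, X)`. -/
noncomputable def embed (hh : IsOrthonormalSystem μ h) (X : Type*) [NormedAddCommGroup X]
    [InnerProductSpace ℂ X] (i : ι) : X →ₗᵢ[ℂ] Lp X 2 μ where
  toFun x := (memLp_smul_const (hh.memLp i) x).toLp
  map_add' x y := by
    rw [← MemLp.toLp_add]
    exact MemLp.toLp_congr _ _ (ae_of_all _ fun ω => smul_add _ _ _)
  map_smul' c x := by
    rw [RingHom.id_apply, ← MemLp.toLp_const_smul]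
    exact MemLp.toLp_congr _ _ (ae_of_all _ fun ω => smul_comm _ _ _)
  norm_map' x := by
    rw [← sq_eq_sq₀ (norm_nonneg _) (norm_nonneg _)]
    have e := inner_toLp_smul_const (hh.memLp i) (hh.memLp i) x x
    rw [hh.integral_conj_mul, if_pos rfl, one_mul, inner_self_eq_norm_sq_to_K,
      inner_self_eq_norm_sq_to_K] at e
    exact_mod_cast e

lemma embed_apply (hh : IsOrthonormalSystem μ h) (i : ι) (x : X) :
    hh.embed X i x = (memLp_smul_const (hh.memLp i) x).toLp := rfl

lemma orthogonalFamily (hh : IsOrthonormalSystem μ h) :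
    OrthogonalFamily ℂ (fun _ : ι => X) (hh.embed X) := by
  intro i j hij x y
  rw [embed_apply, embed_apply, inner_toLp_smul_const (hh.memLp i) (hh.memLp j),
    hh.integral_conj_mul, if_neg hij, zero_mul]

variable [CompleteSpace X]

lemma inner_embed_toLp (hh : IsOrthonormalSystem μ h) {F : Ω → X} (hF : MemLp F 2 μ) (i : ι)
    (x : X) : inner ℂ (hh.embed X i x) hF.toLp = inner ℂ x (coeffWith μ (h i) F) :=
  inner_toLp_smul_const_left (hh.memLp i) hF x

/-- **Bessel's inequality** for vector-valued functions. -/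
lemma sum_norm_sq_coeffWith_le (hh : IsOrthonormalSystem μ h) {F : Ω → X} (hF : MemLp F 2 μ)
    (s : Finset ι) : ∑ i ∈ s, ‖coeffWith μ (h i) F‖ ^ 2 ≤ ‖hF.toLp‖ ^ 2 := by
  set c : ι → X := fun i => coeffWith μ (h i) F with hc
  set S : Lp X 2 μ := ∑ i ∈ s, hh.embed X i (c i) with hS
  have h1 : ‖S‖ ^ 2 = ∑ i ∈ s, ‖c i‖ ^ 2 := hh.orthogonalFamily.norm_sum c s
  have h2 : inner ℂ S hF.toLp = ((∑ i ∈ s, ‖c i‖ ^ 2 : ℝ) : ℂ) := by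
    rw [hS, sum_inner, Complex.ofReal_sum]
    refine Finset.sum_congr rfl fun i _ => ?_
    rw [hh.inner_embed_toLp hF, inner_self_eq_norm_sq_to_K]
    norm_cast
  have h3 : ‖S‖ ^ 2 ≤ ‖S‖ * ‖hF.toLp‖ := by
    have := norm_inner_le_norm (𝕜 := ℂ) S hF.toLp
    rw [h2, Complex.norm_real, Real.norm_eq_abs] at this
    rw [h1]
    exact (le_abs_self _).trans this
  rw [← h1]
  have h4 : ‖S‖ ≤ ‖hF.toLp‖ := by
    by_contra! hlt
    nlinarith [norm_nonneg hF.toLp, norm_nonneg S]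
  gcongr

/-- If only `0` is orthogonal to the system, a function is the sum of its expansion. -/
lemma hasSum_embed (hh : IsOrthonormalSystem μ h)
    (htot : ∀ w : Lp X 2 μ, (∀ i, coeffWith μ (h i) w = 0) → w = 0)
    {F : Ω → X} (hF : MemLp F 2 μ) :
    HasSum (fun i => hh.embed X i (coeffWith μ (h i) F)) hF.toLp := by
  have hO : OrthogonalFamily ℂ (fun _ : ι => X) (hh.embed X) := hh.orthogonalFamily
  have hHS : IsHilbertSum ℂ (fun _ : ι => X) (hh.embed X) := by
    refine IsHilbertSum.mk hO (top_le_iff.2 ?_)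
    rw [Submodule.topologicalClosure_eq_top_iff, Submodule.eq_bot_iff]
    intro w hw
    refine htot w fun i => ?_
    rw [← inner_self_eq_zero (𝕜 := ℂ), ← hh.inner_embed_toLp (Lp.memLp w), Lp.toLp_coeFn]
    exact (Submodule.mem_orthogonal _ _).1 hw _
      (Submodule.mem_iSup_of_mem i (LinearMap.mem_range_self _ _))
  obtain ⟨w, hw⟩ := hHS.surjective_isometry hF.toLp
  have hsum := hO.hasSum_linearIsometry w
  rw [hw] at hsum
  convert hsum using 3 with i
  refine ext_inner_left ℂ fun x => ?_
  rw [← hh.inner_embed_toLp hF]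
  have h1 := hsum.mapL (innerSL ℂ (hh.embed X i x))
  have h2 : HasSum (fun j => inner ℂ (hh.embed X i x) (hh.embed X j (w j)))
      (inner ℂ (hh.embed X i x) (hh.embed X i (w i))) :=
    hasSum_single i fun j hj => hO (Ne.symm hj) _ _
  rw [← LinearIsometry.inner_map_map (hh.embed X i)]
  exact h1.unique h2

/-- The squared error of a partial sum is at most any bound for the sums of the squared norms of
finitely many of the remaining coefficients. -/
lemma eLpNorm_sub_sum_le (hh : IsOrthonormalSystem μ h)
    (htot : ∀ w : Lp X 2 μ, (∀ i, coeffWith μ (h i) w = 0) → w = 0)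
    {F : Ω → X} (hF : MemLp F 2 μ) (s : Finset ι) {B : ℝ} (hB : 0 ≤ B)
    (hs : ∀ t : Finset ι, Disjoint t s → ∑ i ∈ t, ‖coeffWith μ (h i) F‖ ^ 2 ≤ B ^ 2) :
    eLpNorm (fun ω => F ω - ∑ i ∈ s, h i ω • coeffWith μ (h i) F) 2 μ ≤ ENNReal.ofReal B := by
  set c : ι → X := fun i => coeffWith μ (h i) F with hc
  have hO : OrthogonalFamily ℂ (fun _ : ι => X) (hh.embed X) := hh.orthogonalFamily
  have hsum := hh.hasSum_embed htot hF
  have hle : ‖hF.toLp - ∑ i ∈ s, hh.embed X i (c i)‖ ≤ B := by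
    refine le_of_tendsto (hsum.sub_const (∑ i ∈ s, hh.embed X i (c i))).norm ?_
    filter_upwards [eventually_ge_atTop s] with t ht
    rw [← Finset.sum_sdiff ht, add_sub_cancel_right, ← abs_of_nonneg hB,
      ← abs_of_nonneg (norm_nonneg _), ← sq_le_sq]
    rw [hO.norm_sum c]
    exact hs _ Finset.sdiff_disjoint
  have hae : (fun ω => F ω - ∑ i ∈ s, h i ω • c i) =ᵐ[μ]
      (hF.toLp - ∑ i ∈ s, hh.embed X i (c i) : Lp X 2 μ) := by
    have h1 : ∀ᵐ ω ∂μ, ∀ i ∈ s, hh.embed X i (c i) ω = h i ω • c i :=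
      (ae_ball_iff s.countable_toSet).2 fun i _ => (memLp_smul_const (hh.memLp i) (c i)).coeFn_toLp
    filter_upwards [Lp.coeFn_sub hF.toLp (∑ i ∈ s, hh.embed X i (c i)), hF.coeFn_toLp, h1,
      Lp.coeFn_finsetSum s fun i => hh.embed X i (c i)] with ω e1 e2 e3 e4
    rw [e1, Pi.sub_apply, e2, e4, Finset.sum_apply, Finset.sum_congr rfl e3]
  rw [eLpNorm_congr_ae hae, ← Lp.enorm_def, ← ofReal_norm]
  exact ENNReal.ofReal_le_ofReal hle

end IsOrthonormalSystem

end Orthonormal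

/-! ### Multivariate Hermite polynomials -/

instance : IsProbabilityMeasure gammaInf := by
  unfold gammaInf
  infer_instance

/-- The first `N` coordinates of a sequence. -/
def firstCoords (N : ℕ) (y : ℕ → ℝ) : Fin N → ℝ := fun j => y j

lemma measurePreserving_firstCoords (N : ℕ) :
    MeasurePreserving (firstCoords N) gammaInf (gammaFin N) := by
  have hm : Measurable (firstCoords N) := measurable_pi_lambda _ fun j => measurable_pi_apply _
  refine ⟨hm, (Measure.pi_eq fun s hs => ?_).symm⟩
  rw [Measure.map_apply hm (MeasurableSet.univ_pi hs)]
  set t : ℕ → Set ℝ := fun j => if h : j < N then s ⟨j, h⟩ else Set.univ with ht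
  have hpre : firstCoords N ⁻¹' (Set.univ.pi s) = ((Finset.range N : Finset ℕ) : Set ℕ).pi t := by
    ext y
    simp only [Set.mem_preimage, Set.mem_pi, Set.mem_univ, true_implies, firstCoords,
      Finset.coe_range, Set.mem_Iio, ht]
    constructor
    · intro h j hj
      simpa [hj] using h ⟨j, hj⟩
    · intro h j
      simpa using h j j.2
  rw [hpre, gammaInf, Measure.infinitePi_pi, Finset.prod_range]
  · simp [ht]
  · intro j hj
    simp only [ht, Finset.mem_range.1 hj, dif_pos]
    exact hs _

/-- The multi-index `ν` involves only the first `N` coordinates. -/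
def SupportedBelow (N : ℕ) (ν : ℕ →₀ ℕ) : Prop := ν.support ⊆ Finset.range N

lemma exists_forall_supportedBelow (s : Finset (ℕ →₀ ℕ)) :
    ∃ N₀, ∀ N, N₀ ≤ N → ∀ ν ∈ s, SupportedBelow N ν := by
  refine ⟨(s.biUnion Finsupp.support).sup id + 1, fun N hN ν hν j hj => ?_⟩
  have : j ≤ (s.biUnion Finsupp.support).sup id :=
    Finset.le_sup (f := id) (Finset.mem_biUnion.2 ⟨ν, hν, hj⟩)
  exact Finset.mem_range.2 (by omega)

lemma SupportedBelow.ext {N : ℕ} {ν ν' : ℕ →₀ ℕ} (h : SupportedBelow N ν)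
    (h' : SupportedBelow N ν') (heq : ∀ j : Fin N, ν j = ν' j) : ν = ν' := by
  ext j
  by_cases hj : j < N
  · exact heq ⟨j, hj⟩
  · rw [Finsupp.notMem_support_iff.1 fun hm => hj (Finset.mem_range.1 (h hm)),
      Finsupp.notMem_support_iff.1 fun hm => hj (Finset.mem_range.1 (h' hm))]

lemma SupportedBelow.prod_eq {N : ℕ} {ν : ℕ →₀ ℕ} (h : SupportedBelow N ν) (g : ℕ → ℕ → ℝ)
    (hg : ∀ j, g j 0 = 1) : ν.prod g = ∏ j : Fin N, g j (ν j) := by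
  rw [Finsupp.prod_of_support_subset ν h g fun j _ => hg j, Finset.prod_range]

lemma hermiteMulti_eq_prod {N : ℕ} {ν : ℕ →₀ ℕ} (h : SupportedBelow N ν) (y : ℕ → ℝ) :
    hermiteMulti ν y = ∏ j : Fin N, hermiteFun (ν j) (firstCoords N y j) :=
  h.prod_eq _ fun _ => hermiteFun_zero _

/-- The complex-valued Hermite polynomial `H_ν`. -/
noncomputable def hermiteC (ν : ℕ →₀ ℕ) (y : ℕ → ℝ) : ℂ := hermiteMulti ν y

lemma hermiteC_eq_prod {N : ℕ} {ν : ℕ →₀ ℕ} (h : SupportedBelow N ν) (y : ℕ → ℝ) :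
    hermiteC ν y = ∏ j : Fin N, (hermiteFun (ν j) (firstCoords N y j) : ℂ) := by
  rw [hermiteC, hermiteMulti_eq_prod h, Complex.ofReal_prod]

lemma memLp_ofReal_hermiteFun (n : ℕ) :
    MemLp (fun x => (hermiteFun n x : ℂ)) 2 (gaussianReal 0 1) :=
  (memLp_hermiteFun n).ofReal

lemma integral_conj_ofReal_hermiteFun_mul (m n : ℕ) :
    ∫ x, (starRingEnd ℂ) (hermiteFun m x : ℂ) * (hermiteFun n x : ℂ) ∂gaussianReal 0 1 =
      if m = n then 1 else 0 := by
  simp_rw [Complex.conj_ofReal, ← Complex.ofReal_mul]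
  rw [integral_complex_ofReal, integral_hermiteFun_mul_hermiteFun]
  split_ifs <;> simp

/-- The Hermite polynomials are orthonormal in `L²(gammaInf)`. -/
lemma isOrthonormalSystem_hermiteC : IsOrthonormalSystem gammaInf hermiteC where
  memLp ν := by
    obtain ⟨N, hN⟩ := exists_forall_supportedBelow {ν}
    have h : SupportedBelow N ν := hN N le_rfl ν (by simp)
    have := (memLp_prod_pi (ι := Fin N) fun j =>
      memLp_ofReal_hermiteFun (ν j)).comp_measurePreserving (measurePreserving_firstCoords N)
    exact this.ae_eq (ae_of_all _ fun y => (hermiteC_eq_prod h y).symm)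
  integral_conj_mul ν ν' := by
    obtain ⟨N, hN⟩ := exists_forall_supportedBelow {ν, ν'}
    have h : SupportedBelow N ν := hN N le_rfl ν (by simp)
    have h' : SupportedBelow N ν' := hN N le_rfl ν' (by simp)
    have key := integral_conj_prod_mul_prod integral_conj_ofReal_hermiteFun_mul
      (fun j : Fin N => ν j) (fun j : Fin N => ν' j)
    change ∫ y, _ ∂(gammaFin N) = _ at key
    have hc : Continuous fun y : Fin N → ℝ =>
        (starRingEnd ℂ) (∏ j : Fin N, (hermiteFun (ν j) (y j) : ℂ)) *
          ∏ j : Fin N, (hermiteFun (ν' j) (y j) : ℂ) := by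
      have hp : ∀ ν : ℕ →₀ ℕ, Continuous fun y : Fin N → ℝ =>
          ∏ j : Fin N, (hermiteFun (ν j) (y j) : ℂ) := fun ν =>
        continuous_finsetProd _ fun j _ => Complex.continuous_ofReal.comp
          ((continuous_hermiteFun _).comp (continuous_apply j))
      exact (Complex.continuous_conj.comp (hp ν)).mul (hp ν')
    rw [← (measurePreserving_firstCoords N).map_eq,
      integral_map (measurePreserving_firstCoords N).aemeasurable hc.aestronglyMeasurable] at key
    simp only [hermiteC_eq_prod h, hermiteC_eq_prod h', key]
    have hiff : ((fun j : Fin N => ν j) = fun j : Fin N => ν' j) ↔ ν = ν' :=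
      ⟨fun e => h.ext h' (congrFun e), fun e => by rw [e]⟩
    simp only [hiff]

lemma memLp_hermiteMulti (ν : ℕ →₀ ℕ) : MemLp (hermiteMulti ν) 2 gammaInf :=
  (isOrthonormalSystem_hermiteC.memLp ν).re

lemma coeffWith_hermiteC {X : Type*} [NormedAddCommGroup X] [InnerProductSpace ℂ X]
    (u : (ℕ → ℝ) → X) (ν : ℕ →₀ ℕ) : coeffWith gammaInf (hermiteC ν) u = hermiteCoeff u ν := by
  simp only [coeffWith, hermiteC, hermiteCoeff, Complex.conj_ofReal, Complex.coe_smul]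

/-! ### Completeness of the Hermite polynomials -/

/-- The span of the Hermite polynomials, which contains all polynomials. -/
noncomputable def hermiteSpan : Submodule ℝ ((ℕ → ℝ) → ℝ) :=
  Submodule.span ℝ (Set.range hermiteMulti)

lemma hermiteMulti_update (ν : ℕ →₀ ℕ) (j n : ℕ) (y : ℕ → ℝ) :
    hermiteMulti (ν.update j n) y = hermiteFun n (y j) * hermiteMulti (ν.erase j) y := by
  have h := Finsupp.mul_prod_erase' (ν.update j n) j (fun j k => hermiteFun k (y j))
    fun _ => hermiteFun_zero _
  have he : (ν.update j n).erase j = ν.erase j := by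
    ext i
    by_cases hi : i = j
    · subst hi
      simp
    · simp [Finsupp.erase_ne hi]
  rw [he] at h
  simpa [hermiteMulti] using h.symm

lemma coord_mul_mem_hermiteSpan (j : ℕ) {g : (ℕ → ℝ) → ℝ} (hg : g ∈ hermiteSpan) :
    (fun y => y j * g y) ∈ hermiteSpan := by
  induction hg using Submodule.span_induction with
  | mem g hg =>
    obtain ⟨ν, rfl⟩ := hg
    have e : (fun y : ℕ → ℝ => y j * hermiteMulti ν y) =
        √(ν j + 1 : ℝ) • hermiteMulti (ν.update j (ν j + 1)) +
          √(ν j : ℝ) • hermiteMulti (ν.update j (ν j - 1)) := by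
      ext y
      have h0 := hermiteMulti_update ν j (ν j) y
      rw [Finsupp.update_self] at h0
      simp only [Pi.add_apply, Pi.smul_apply, smul_eq_mul, hermiteMulti_update, h0]
      rw [← mul_assoc, mul_hermiteFun]
      ring
    rw [e]
    exact add_mem (Submodule.smul_mem _ _ (Submodule.subset_span ⟨_, rfl⟩))
      (Submodule.smul_mem _ _ (Submodule.subset_span ⟨_, rfl⟩))
  | zero =>
    simp only [Pi.zero_apply, mul_zero]
    exact zero_mem _
  | add f g _ _ hf hg =>
    simp only [Pi.add_apply, mul_add]
    exact add_mem hf hg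
  | smul a f _ hf =>
    have := Submodule.smul_mem _ a hf
    convert this using 1
    ext y
    simp only [Pi.smul_apply, smul_eq_mul]
    ring

/-- The linear form `∑_{i ∈ I} t_i y_i`. -/
def linForm (I : Finset ℕ) (t : I → ℝ) (y : ℕ → ℝ) : ℝ := ∑ i, t i * y i

lemma linForm_pow_mem_hermiteSpan (I : Finset ℕ) (t : I → ℝ) (k : ℕ) :
    (fun y => linForm I t y ^ k) ∈ hermiteSpan := by
  induction k with
  | zero =>
    refine Submodule.subset_span ⟨0, ?_⟩
    ext y
    simp [hermiteMulti]
  | succ k ih =>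
    have e : (fun y => linForm I t y ^ (k + 1)) =
        ∑ i, t i • fun y : ℕ → ℝ => y i * linForm I t y ^ k := by
      ext y
      simp only [Finset.sum_apply, Pi.smul_apply, smul_eq_mul, ← mul_assoc]
      rw [← Finset.sum_mul, pow_succ']
      rfl
    rw [e]
    exact Submodule.sum_mem _ fun i _ =>
      Submodule.smul_mem _ _ (coord_mul_mem_hermiteSpan _ ih)

lemma integral_mul_eq_zero_of_mem_hermiteSpan {f : (ℕ → ℝ) → ℝ} (hf : MemLp f 2 gammaInf)
    (h0 : ∀ ν, ∫ y, hermiteMulti ν y * f y ∂gammaInf = 0) {g : (ℕ → ℝ) → ℝ}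
    (hg : g ∈ hermiteSpan) : MemLp g 2 gammaInf ∧ ∫ y, g y * f y ∂gammaInf = 0 := by
  induction hg using Submodule.span_induction with
  | mem g hg =>
    obtain ⟨ν, rfl⟩ := hg
    exact ⟨memLp_hermiteMulti ν, h0 ν⟩
  | zero => exact ⟨MemLp.zero, by simp⟩
  | add g g' _ _ hg hg' =>
    refine ⟨hg.1.add hg'.1, ?_⟩
    simp only [Pi.add_apply, add_mul]
    have i1 : Integrable (fun y => g y * f y) gammaInf := hg.1.integrable_mul hf
    have i2 : Integrable (fun y => g' y * f y) gammaInf := hg'.1.integrable_mul hf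
    rw [integral_add i1 i2, hg.2, hg'.2, add_zero]
  | smul a g _ hg =>
    refine ⟨hg.1.const_smul a, ?_⟩
    simp only [Pi.smul_apply, smul_eq_mul, mul_assoc]
    rw [integral_const_mul, hg.2, mul_zero]

lemma continuous_linForm (I : Finset ℕ) (t : I → ℝ) : Continuous (linForm I t) := by
  unfold linForm
  fun_prop

lemma integrable_exp_linForm (I : Finset ℕ) (t : I → ℝ) :
    Integrable (fun y => Real.exp (linForm I t y)) gammaInf := by
  have h1 : Integrable (fun x : I → ℝ => ∏ i, Real.exp (t i * x i))
      (Measure.pi fun _ : I => gaussianReal 0 1) :=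
    Integrable.fintype_prod (f := fun i x => Real.exp (t i * x))
      fun i => integrable_exp_mul_gaussianReal (t i)
  rw [← Measure.infinitePi_map_restrict (fun _ : ℕ => gaussianReal 0 1)] at h1
  have h2 := h1.comp_measurable (Finset.measurable_restrict I)
  rw [gammaInf]
  convert h2 using 2 with y
  simp [linForm, Real.exp_sum]

lemma memLp_exp_abs_linForm (I : Finset ℕ) (t : I → ℝ) :
    MemLp (fun y => Real.exp |linForm I t y|) 2 gammaInf := by
  have hc : Continuous fun y => Real.exp |linForm I t y| :=
    Real.continuous_exp.comp (continuous_linForm I t).abs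
  have e2 : ∀ (s : ℝ) y, linForm I (fun i => s * t i) y = s * linForm I t y := fun s y => by
    simp [linForm, Finset.mul_sum, mul_assoc]
  rw [memLp_two_iff_integrable_sq hc.aestronglyMeasurable]
  refine ((integrable_exp_linForm I fun i => 2 * t i).add
    (integrable_exp_linForm I fun i => -2 * t i)).mono' (hc.pow 2).aestronglyMeasurable
    (ae_of_all _ fun y => ?_)
  simp only [Pi.add_apply, e2]
  rw [Real.norm_of_nonneg (by positivity), ← Real.exp_nat_mul]
  rcases abs_cases (linForm I t y) with ⟨h, _⟩ | ⟨h, _⟩ <;> rw [h]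
  · have := Real.exp_pos (-2 * linForm I t y)
    push_cast
    linarith
  · have := Real.exp_pos (2 * linForm I t y)
    push_cast
    rw [mul_neg, ← neg_mul]
    linarith

/-- A function orthogonal to all Hermite polynomials is orthogonal to the characters: expand the
exponential series, which converges dominatedly since `exp |linForm|` is square integrable. -/
lemma integral_exp_linForm_mul_eq_zero {f : (ℕ → ℝ) → ℝ} (hf : MemLp f 2 gammaInf)
    (h0 : ∀ ν, ∫ y, hermiteMulti ν y * f y ∂gammaInf = 0) (I : Finset ℕ) (t : I → ℝ) :
    ∫ y, Complex.exp (linForm I t y * Complex.I) * f y ∂gammaInf = 0 := by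
  have hZ := continuous_linForm I t
  have key : HasSum (fun n : ℕ => ∫ y, ((linForm I t y * Complex.I : ℂ) ^ n / n !) * f y ∂gammaInf)
      (∫ y, Complex.exp (linForm I t y * Complex.I) * f y ∂gammaInf) := by
    have hs : ∀ y, HasSum (fun n : ℕ => |linForm I t y| ^ n / n ! * |f y|)
        (Real.exp |linForm I t y| * |f y|) := fun y => by
      have := NormedSpace.expSeries_div_hasSum_exp |linForm I t y|
      rw [← Real.exp_eq_exp_ℝ] at this
      exact this.mul_right _
    refine hasSum_integral_of_dominated_convergence
      (fun n y => |linForm I t y| ^ n / n ! * |f y|) (fun n => ?_)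
      (fun n => ae_of_all _ fun y => ?_) (ae_of_all _ fun y => (hs y).summable) ?_
      (ae_of_all _ fun y => ?_)
    · refine Continuous.aestronglyMeasurable (by fun_prop) |>.mul ?_
      exact Complex.continuous_ofReal.comp_aestronglyMeasurable hf.1
    · simp
    · simp only [(hs _).tsum_eq]
      exact (memLp_exp_abs_linForm I t).integrable_mul hf.abs
    · have := NormedSpace.expSeries_div_hasSum_exp (linForm I t y * Complex.I : ℂ)
      rw [← Complex.exp_eq_exp_ℂ] at this
      exact this.mul_right _
  have hz : ∀ n : ℕ, ∫ y, ((linForm I t y * Complex.I : ℂ) ^ n / n !) * f y ∂gammaInf = 0 := by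
    intro n
    have h1 := (integral_mul_eq_zero_of_mem_hermiteSpan hf h0
      (linForm_pow_mem_hermiteSpan I t n)).2
    have e : ∀ y, ((linForm I t y * Complex.I : ℂ) ^ n / n !) * f y =
        (Complex.I ^ n / n !) * ((linForm I t y ^ n * f y : ℝ) : ℂ) := fun y => by
      push_cast
      ring
    simp_rw [e]
    rw [integral_const_mul, integral_complex_ofReal, h1]
    simp
  simp only [hz] at key
  exact key.unique hasSum_zero

/-- A real square-integrable function orthogonal to all Hermite polynomials vanishes: its positive
and negative parts are densities of two finite measures with the same finite-dimensional
characteristic functions. -/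
lemma ae_eq_zero_of_integral_hermiteMulti_mul {f : (ℕ → ℝ) → ℝ} (hf : MemLp f 2 gammaInf)
    (h0 : ∀ ν, ∫ y, hermiteMulti ν y * f y ∂gammaInf = 0) : f =ᵐ[gammaInf] 0 := by
  have hfi : Integrable f gammaInf := hf.integrable one_le_two
  set μp := gammaInf.withDensity fun y => ENNReal.ofReal (f y) with hμp
  set μn := gammaInf.withDensity fun y => ENNReal.ofReal (-f y) with hμn
  have : IsFiniteMeasure μp := isFiniteMeasure_withDensity_ofReal hfi.2
  have : IsFiniteMeasure μn := isFiniteMeasure_withDensity_ofReal hfi.neg.2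
  have hI : ∀ I : Finset ℕ, μp.map I.restrict = μn.map I.restrict := by
    intro I
    refine Measure.ext_of_charFunDual (funext fun L => ?_)
    have hr := Finset.measurable_restrict (X := fun _ => ℝ) I
    have hL : ∀ y : ℕ → ℝ, L (I.restrict y) = linForm I (fun i => L (Pi.single i 1)) y := by
      intro y
      conv_lhs => rw [pi_eq_sum_univ' (I.restrict y)]
      simp [linForm, mul_comm]
    have hc : Continuous fun v : I → ℝ => Complex.exp (L v * Complex.I) := by fun_prop
    rw [charFunDual_apply, charFunDual_apply,
      integral_map hr.aemeasurable hc.aestronglyMeasurable,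
      integral_map hr.aemeasurable hc.aestronglyMeasurable]
    simp only [hL]
    have hn : AEMeasurable (fun y => -f y) gammaInf := hf.1.aemeasurable.neg
    have hint : ∀ g : (ℕ → ℝ) → ℝ, AEMeasurable g gammaInf → (∀ y, |g y| ≤ |f y|) →
        Integrable (fun y => (ENNReal.ofReal (g y)).toReal •
          Complex.exp (linForm I (fun i => L (Pi.single i 1)) y * Complex.I)) gammaInf := by
      intro g hg hgf
      refine Integrable.mono' (g := fun y => |f y|) hfi.abs ?_ (ae_of_all _ fun y => ?_)
      · have := continuous_linForm I fun i => L (Pi.single i 1)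
        exact hg.ennreal_ofReal.ennreal_toReal.aestronglyMeasurable.smul
          (Continuous.aestronglyMeasurable (by fun_prop))
      · rw [norm_smul, Complex.norm_exp_ofReal_mul_I, mul_one, ENNReal.toReal_ofReal',
          Real.norm_of_nonneg (le_max_right _ _)]
        exact (max_le (le_abs_self _) (abs_nonneg _)).trans (hgf y)
    rw [hμp, hμn, integral_withDensity_eq_integral_toReal_smul₀ hf.1.aemeasurable.ennreal_ofReal
        (ae_of_all _ fun _ => ENNReal.ofReal_lt_top),
      integral_withDensity_eq_integral_toReal_smul₀ hn.ennreal_ofReal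
        (ae_of_all _ fun _ => ENNReal.ofReal_lt_top), ← sub_eq_zero,
      ← integral_sub (hint _ hf.1.aemeasurable fun _ => le_rfl) (hint _ hn fun y => by simp),
      ← integral_exp_linForm_mul_eq_zero hf h0 I fun i => L (Pi.single i 1)]
    refine integral_congr_ae (ae_of_all _ fun y => ?_)
    simp only [ENNReal.toReal_ofReal', Complex.real_smul]
    rw [← sub_mul, mul_comm, ← Complex.ofReal_sub, max_zero_sub_max_neg_zero_eq_self]
  have heq : μp = μn := IsProjectiveLimit.unique (P := fun I => μn.map I.restrict) hI fun _ => rfl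
  have hae := (withDensity_eq_iff_of_sigmaFinite hf.1.aemeasurable.ennreal_ofReal
    hf.1.aemeasurable.neg.ennreal_ofReal).1 heq
  filter_upwards [hae] with y hy
  have h3 := congrArg ENNReal.toReal hy
  rw [ENNReal.toReal_ofReal', ENNReal.toReal_ofReal'] at h3
  have h4 := max_zero_sub_max_neg_zero_eq_self (f y)
  rw [Pi.zero_apply, ← h4]
  exact sub_eq_zero.2 h3

/-- Only `0` is orthogonal to all Hermite polynomials in `L²(gammaInf, X)`. -/
lemma eq_zero_of_coeffWith_hermiteC {X : Type*} [NormedAddCommGroup X] [InnerProductSpace ℂ X]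
    [CompleteSpace X] [SecondCountableTopology X] (w : Lp X 2 gammaInf)
    (hw : ∀ ν, coeffWith gammaInf (hermiteC ν) w = 0) : w = 0 := by
  have hwL : MemLp w 2 gammaInf := Lp.memLp w
  rw [Lp.eq_zero_iff_ae_eq_zero]
  refine ae_eq_zero_of_forall_inner (𝕜 := ℂ) fun x => ?_
  have hin : MemLp (fun y => inner ℂ x (w y)) 2 gammaInf := hwL.const_inner x
  have hc : ∀ ν, ∫ y, (hermiteMulti ν y : ℂ) * inner ℂ x (w y) ∂gammaInf = 0 := by
    intro ν
    have h1 := integral_inner (𝕜 := ℂ)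
      (integrable_conj_smul (isOrthonormalSystem_hermiteC.memLp ν) hwL) x
    have h2 : ∫ y, (starRingEnd ℂ) (hermiteC ν y) • w y ∂gammaInf = 0 := hw ν
    rw [h2, inner_zero_right] at h1
    rw [← h1]
    refine integral_congr_ae (ae_of_all _ fun y => ?_)
    simp only [hermiteC, Complex.conj_ofReal, inner_smul_right]
  have hint : ∀ ν, Integrable (fun y => (hermiteMulti ν y : ℂ) * inner ℂ x (w y)) gammaInf :=
    fun ν => (isOrthonormalSystem_hermiteC.memLp ν).integrable_mul hin
  have hre := ae_eq_zero_of_integral_hermiteMulti_mul hin.re fun ν => by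
    have := integral_re (hint ν)
    rw [hc ν] at this
    simpa [Complex.mul_re] using this
  have him := ae_eq_zero_of_integral_hermiteMulti_mul hin.im fun ν => by
    have := integral_im (hint ν)
    rw [hc ν] at this
    simpa [Complex.mul_im] using this
  filter_upwards [hre, him] with y h1 h2
  exact Complex.ext h1 h2

/-! ### Weighted square summability of the Hermite coefficients -/

/-- The mean square modulus of the Hermite polynomial `H_n` on shifts over the circle of radius
`κ`; it equals the value at `-κ²` of the `n`-th Laguerre polynomial. -/
noncomputable def shiftWeight (κ : ℝ) (n : ℕ) : ℝ :=
  ∑ l ∈ Finset.range (n + 1), (n.choose l : ℝ) * κ ^ (2 * l) / l !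

lemma shiftWeight_zero (κ : ℝ) : shiftWeight κ 0 = 1 := by
  simp [shiftWeight]

lemma isOrthonormalSystem_waveHermite (N : ℕ) :
    IsOrthonormalSystem (torusGaussian N)
      (fun (k : Fin N → ℕ × ℕ) ω => ∏ j, waveHermite (k j) (ω j)) where
  memLp k := memLp_prod_pi fun j => memLp_waveHermite (k j)
  integral_conj_mul k k' := by
    rw [integral_conj_prod_mul_prod integral_conj_waveHermite_mul k k']

section FiniteDimensional

variable {X : Type*} [NormedAddCommGroup X] [InnerProductSpace ℂ X] [CompleteSpace X]
  {N : ℕ} {ϱ κ : Fin N → ℝ} {U : (Fin N → ℂ) → X} {Φ : (Fin N → ℝ) → ℝ} {δ : ℝ}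

/-- Bessel's inequality on the torus of radii `κ` bounds a weighted sum of the squared norms of
the Hermite coefficients. -/
lemma sum_prod_shiftWeight_mul_le (hδ : 0 ≤ δ) (hκ : ∀ j, 0 < κ j) (hκϱ : ∀ j, κ j < ϱ j)
    (hU : DifferentiableOn ℂ U (strip ϱ)) (hΦ : MemLp Φ 2 (gammaFin N))
    (hΦδ : eLpNorm Φ 2 (gammaFin N) ≤ ENNReal.ofReal δ)
    (hUΦ : ∀ z ∈ polydisc ϱ, ∀ y : Fin N → ℝ, ‖U (toComplex y + z)‖ ≤ Φ y)
    (s : Finset (Fin N → ℕ)) :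
    ∑ ν ∈ s, (∏ j, shiftWeight (κ j) (ν j)) *
      ‖∫ y, (∏ j, hermiteFun (ν j) (y j)) • U (toComplex y) ∂gammaFin N‖ ^ 2 ≤ δ ^ 2 := by
  classical
  set c : (Fin N → ℕ) → X := fun ν =>
    ∫ y, (∏ j, hermiteFun (ν j) (y j)) • U (toComplex y) ∂gammaFin N with hc
  set F : (Fin N → ℝ × ℝ) → X := fun ω => U (toComplex (realPart ω) + partialShift κ ∅ ω) with hF
  have hFL : MemLp F 2 (torusGaussian N) := memLp_comp_partialShift hκ hκϱ hU hΦ hUΦ ∅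
  have hnorm : ‖hFL.toLp‖ ≤ δ := by
    rw [Lp.norm_toLp]
    refine ENNReal.toReal_le_of_le_ofReal hδ (le_trans ?_ hΦδ)
    rw [← eLpNorm_comp_measurePreserving hΦ.1 measurePreserving_realPart]
    exact eLpNorm_mono_real fun ω => hUΦ _ (partialShift_mem_polydisc hκ hκϱ ∅ ω) _
  -- The pairs `(ν, l)` with `l ≤ ν` parametrize the indices `(l, ν - l)` of the torus system.
  set T : Finset (Σ _ : Fin N → ℕ, Fin N → ℕ) :=
    s.sigma fun ν => Fintype.piFinset fun j => Finset.range (ν j + 1) with hT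
  have hTle : ∀ p ∈ T, ∀ j, p.2 j ≤ p.1 j := fun p hp j =>
    Nat.lt_succ_iff.1 (Finset.mem_range.1 (Fintype.mem_piFinset.1 (Finset.mem_sigma.1 hp).2 j))
  set ix : (Σ _ : Fin N → ℕ, Fin N → ℕ) → Fin N → ℕ × ℕ := fun p j => (p.2 j, p.1 j - p.2 j)
    with hix
  have hinj : Set.InjOn ix T := by
    rintro ⟨ν, l⟩ hp ⟨ν', l'⟩ hp' he
    have h1 : ∀ j, l j = l' j ∧ ν j = ν' j := fun j => by
      have h := Prod.ext_iff.1 (congrFun he j)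
      have a := hTle _ hp j
      have a' := hTle _ hp' j
      simp only [hix] at h a a'
      omega
    have e1 : ν = ν' := funext fun j => (h1 j).2
    have e2 : l = l' := funext fun j => (h1 j).1
    rw [e1, e2]
  have hB := (isOrthonormalSystem_waveHermite N).sum_norm_sq_coeffWith_le hFL (T.image ix)
  rw [Finset.sum_image hinj] at hB
  refine le_trans (le_of_eq ?_) (hB.trans (by gcongr))
  have hterm : ∀ p ∈ T, ‖coeffWith (torusGaussian N)
      (fun ω => ∏ j, waveHermite (ix p j) (ω j)) F‖ ^ 2 =
        (∏ j, ((p.1 j).choose (p.2 j) : ℝ) * κ j ^ (2 * p.2 j) / (p.2 j)!) * ‖c p.1‖ ^ 2 := by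
    intro p hp
    have hk : ∀ j, (ix p j).2 + (ix p j).1 = p.1 j := fun j => by
      have := hTle p hp j
      simp only [hix]
      omega
    have key := integral_conj_prod_waveHermite_smul hκ hκϱ hU hΦ hUΦ (ix p)
    rw [coeffWith, key, norm_smul, mul_pow, norm_prod, ← Finset.prod_pow]
    simp only [Real.norm_eq_abs, sq_abs, shiftFactor_sq, hk]
    simp only [hix, hc]
  rw [Finset.sum_congr rfl hterm, hT, Finset.sum_sigma]
  refine Finset.sum_congr rfl fun ν _ => ?_
  simp only
  rw [← Finset.sum_mul]
  simp only [shiftWeight, Finset.prod_univ_sum, hc]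

end FiniteDimensional

section Limit

variable {X : Type*} [NormedAddCommGroup X] [InnerProductSpace ℂ X] [CompleteSpace X]

/-- The Hermite coefficients depend continuously on the function in `L²`. -/
lemma norm_hermiteCoeff_sub_le {u v : (ℕ → ℝ) → X} (hu : MemLp u 2 gammaInf)
    (hv : MemLp v 2 gammaInf) (ν : ℕ →₀ ℕ) :
    ‖hermiteCoeff u ν - hermiteCoeff v ν‖ ≤
      (eLpNorm (fun y => u y - v y) 2 gammaInf).toReal := by
  have huv : MemLp (fun y => u y - v y) 2 gammaInf := hu.sub hv
  have hb := isOrthonormalSystem_hermiteC.sum_norm_sq_coeffWith_le huv {ν}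
  rw [Finset.sum_singleton, sq_le_sq₀ (norm_nonneg _) (norm_nonneg _), Lp.norm_toLp] at hb
  refine le_of_eq_of_le ?_ hb
  have h := isOrthonormalSystem_hermiteC.memLp ν
  rw [← coeffWith_hermiteC, ← coeffWith_hermiteC, coeffWith, coeffWith, coeffWith,
    ← integral_sub (integrable_conj_smul h hu) (integrable_conj_smul h hv)]
  simp only [smul_sub]

/-- Weighted square summability of the Hermite coefficients of a holomorphic function, for radii
that are admissible with a margin. -/
lemma IsHolomorphic.sum_prod_shiftWeight_mul_le {b : ℕ → ℝ} {ξ δ : ℝ} (hδ : 0 ≤ δ)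
    {u : (ℕ → ℝ) → X} (hu : IsHolomorphic b ξ δ u) {κ : ℕ → ℝ} (hκ : ∀ j, 0 < κ j)
    (hadm : ∀ N, ∑ j ∈ Finset.range N, b j ^ 2 * (2 * κ j) ^ 2 ≤ ξ ^ 2)
    (s : Finset (ℕ →₀ ℕ)) :
    ∑ ν ∈ s, (ν.prod fun j n => shiftWeight (κ j) n) * ‖hermiteCoeff u ν‖ ^ 2 ≤ δ ^ 2 := by
  classical
  obtain ⟨huL, uN, U, phi, hhol, -, hphi, hbound, hconv⟩ := hu
  obtain ⟨N₀, hN₀⟩ := exists_forall_supportedBelow s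
  have hA : ∀ N, Admissible b ξ (fun j : Fin N => 2 * κ j) := fun N =>
    ⟨fun j => by have := hκ j; positivity, by
      rw [← Finset.sum_range fun j => b j ^ 2 * (2 * κ j) ^ 2]; exact hadm N⟩
  set v : ℕ → (ℕ → ℝ) → X := fun N y => uN N (firstCoords N y) with hv
  have hcont : ∀ N, 1 ≤ N → Continuous (uN N) := by
    intro N hN
    obtain ⟨hd, he⟩ := hhol N hN _ (hA N)
    have h1 : uN N = fun y => U N (fun j : Fin N => 2 * κ j) (toComplex y) :=
      funext fun y => (he y).symm
    rw [h1]
    refine hd.continuousOn.comp_continuous continuous_toComplex fun y j => ?_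
    simpa [toComplex] using hκ j
  have hvL : ∀ N, 1 ≤ N → MemLp (v N) 2 gammaInf := by
    intro N hN
    obtain ⟨hd, he⟩ := hhol N hN _ (hA N)
    refine MemLp.comp_measurePreserving (g := uN N) ?_ (measurePreserving_firstCoords N)
    refine (hphi N hN).2.1.mono' (hcont N hN).aestronglyMeasurable (ae_of_all _ fun y => ?_)
    have h2 := hbound N hN _ (hA N) 0 (fun j => by simpa using hκ j) y
    rwa [add_zero, he y] at h2
  have hlim : ∀ ν, Tendsto (fun N => hermiteCoeff (v N) ν) atTop (𝓝 (hermiteCoeff u ν)) := by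
    intro ν
    rw [tendsto_iff_norm_sub_tendsto_zero]
    have h1 := (ENNReal.tendsto_toReal ENNReal.zero_ne_top).comp hconv
    refine squeeze_zero' (Eventually.of_forall fun _ => norm_nonneg _) ?_ h1
    filter_upwards [eventually_ge_atTop 1] with N hN
    rw [norm_sub_rev]
    exact norm_hermiteCoeff_sub_le huL (hvL N hN) ν
  refine le_of_tendsto (tendsto_finsetSum s fun ν _ => ((hlim ν).norm.pow 2).const_mul _) ?_
  filter_upwards [eventually_ge_atTop (max N₀ 1)] with N hN
  have hN1 : 1 ≤ N := (le_max_right _ _).trans hN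
  have hs := hN₀ N ((le_max_left _ _).trans hN)
  obtain ⟨hd, he⟩ := hhol N hN1 _ (hA N)
  obtain ⟨-, hphiL, hphiδ⟩ := hphi N hN1
  have key := HermiteApprox.sum_prod_shiftWeight_mul_le (κ := fun j : Fin N => κ j) hδ
    (fun j => hκ j) (fun j => by have := hκ j; linarith) hd hphiL hphiδ (hbound N hN1 _ (hA N))
    (s.image fun (ν : ℕ →₀ ℕ) (j : Fin N) => ν j)
  rw [Finset.sum_image fun ν hν ν' hν' e => (hs ν hν).ext (hs ν' hν') (congrFun e)] at key
  refine le_trans (le_of_eq (Finset.sum_congr rfl fun ν hν => ?_)) key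
  rw [(hs ν hν).prod_eq (fun j n => shiftWeight (κ j) n) fun j => shiftWeight_zero _]
  congr 3
  have hint : Continuous fun y : Fin N → ℝ => (∏ j : Fin N, hermiteFun (ν j) (y j)) • uN N y :=
    (continuous_finsetProd _ fun j _ =>
      (continuous_hermiteFun _).comp (continuous_apply j)).smul (hcont N hN1)
  simp only [he]
  rw [hermiteCoeff, ← (measurePreserving_firstCoords N).map_eq,
    integral_map (measurePreserving_firstCoords N).aemeasurable hint.aestronglyMeasurable]
  simp only [hermiteMulti_eq_prod (hs ν hν), hv]

end Limit

/-! ### Comparison of the weights -/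

/-- Lower bound by the terms `l = 1` (if `n ≤ M`) and `l = M` (if `M ≤ n`) of `shiftWeight`. -/
lemma le_shiftWeight {M : ℕ} (hM : 1 ≤ M) (κ : ℝ) {n : ℕ} (hn : 1 ≤ n) :
    min (κ ^ 2) (κ ^ (2 * M)) * (n : ℝ) ^ M ≤ (M : ℝ) ^ M * (M ! : ℝ) ^ 2 * shiftWeight κ n := by
  have hterm : ∀ l, 0 ≤ (n.choose l : ℝ) * κ ^ (2 * l) / l ! := fun l => by
    rw [pow_mul]
    positivity
  have hle : ∀ l ≤ n, (n.choose l : ℝ) * κ ^ (2 * l) / l ! ≤ shiftWeight κ n := fun l hl =>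
    Finset.single_le_sum (f := fun l => (n.choose l : ℝ) * κ ^ (2 * l) / l !)
      (fun l _ => hterm l) (Finset.mem_range.2 (Nat.lt_succ_of_le hl))
  have hf : (1 : ℝ) ≤ (M ! : ℝ) := by exact_mod_cast Nat.factorial_pos M
  rcases le_total n M with h | h
  · have h1 := hle 1 hn
    simp only [Nat.choose_one_right, mul_one, Nat.factorial_one, Nat.cast_one, div_one] at h1
    have hn1 : (1 : ℝ) ≤ n := by exact_mod_cast hn
    calc min (κ ^ 2) (κ ^ (2 * M)) * (n : ℝ) ^ M ≤ κ ^ 2 * (M : ℝ) ^ M := by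
          gcongr
          exact min_le_left _ _
      _ ≤ (n * κ ^ 2) * ((M : ℝ) ^ M * (M ! : ℝ) ^ 2) := by
          have hf2 : (1 : ℝ) ≤ (M ! : ℝ) ^ 2 := one_le_pow₀ hf
          exact mul_le_mul (le_mul_of_one_le_left (sq_nonneg _) hn1)
            (le_mul_of_one_le_right (by positivity) hf2) (by positivity) (by positivity)
      _ ≤ shiftWeight κ n * ((M : ℝ) ^ M * (M ! : ℝ) ^ 2) := by gcongr
      _ = _ := mul_comm _ _
  · have h1 := hle M h
    have h2 : (((n + 1 - M : ℕ) : ℝ) ^ M) / M ! ≤ n.choose M := Nat.pow_le_choose M n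
    have h3 : (n : ℝ) ≤ M * ((n + 1 - M : ℕ) : ℝ) := by
      have : n ≤ M * (n + 1 - M) := by
        obtain ⟨d, rfl⟩ := Nat.exists_eq_add_of_le h
        obtain ⟨e, rfl⟩ := Nat.exists_eq_add_of_le hM
        have : 1 + e + d + 1 - (1 + e) = d + 1 := by omega
        rw [this]
        nlinarith
      exact_mod_cast this
    have hκ : 0 ≤ κ ^ (2 * M) := by
      rw [pow_mul]
      positivity
    calc min (κ ^ 2) (κ ^ (2 * M)) * (n : ℝ) ^ M
        ≤ κ ^ (2 * M) * (M * ((n + 1 - M : ℕ) : ℝ)) ^ M := by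
          gcongr
          exact min_le_right _ _
      _ = (M : ℝ) ^ M * (M ! : ℝ) ^ 2 *
            ((((n + 1 - M : ℕ) : ℝ) ^ M) / M ! * κ ^ (2 * M) / M !) := by
          rw [mul_pow]
          field_simp
      _ ≤ (M : ℝ) ^ M * (M ! : ℝ) ^ 2 * ((n.choose M : ℝ) * κ ^ (2 * M) / M !) := by gcongr
      _ ≤ _ := by gcongr

lemma weight_pos (K : ℝ) (ϱ : ℕ → ℝ) (M : ℕ) (ν : ℕ →₀ ℕ) : 0 < weight K ϱ M ν := by
  refine Finset.prod_pos fun j hj => ?_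
  have h1 : 0 < ν j := Nat.pos_of_ne_zero (Finsupp.mem_support_iff.1 hj)
  have h2 : (0 : ℝ) < max 1 (K * ϱ j) := lt_of_lt_of_le one_pos (le_max_left _ _)
  have h3 : (0 : ℝ) < (ν j : ℝ) := by exact_mod_cast h1
  positivity

/-- Termwise comparison of two product weights, up to factors different from `1` at finitely many
places only. -/
lemma exists_mul_prod_le {f g : ℕ → ℕ → ℝ} {d : ℕ → ℝ} {s : Finset ℕ} (hd : ∀ j, 0 < d j)
    (hd1 : ∀ j, d j ≤ 1) (hs : ∀ j ∉ s, d j = 1) (hg : ∀ j n, 1 ≤ n → 0 ≤ g j n)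
    (hfg : ∀ j n, 1 ≤ n → d j * g j n ≤ f j n) :
    ∃ C : ℝ, 0 < C ∧ ∀ ν : ℕ →₀ ℕ, C * ν.prod g ≤ ν.prod f := by
  refine ⟨∏ j ∈ s, d j, Finset.prod_pos fun j _ => hd j, fun ν => ?_⟩
  have hpos : ∀ j ∈ ν.support, 1 ≤ ν j := fun j hj =>
    Nat.one_le_iff_ne_zero.2 (Finsupp.mem_support_iff.1 hj)
  have h1 : ∏ j ∈ s, d j ≤ ∏ j ∈ ν.support, d j := by
    have e : ∏ j ∈ ν.support, d j = ∏ j ∈ s.filter (· ∈ ν.support), d j := by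
      symm
      refine Finset.prod_subset (fun j hj => (Finset.mem_filter.1 hj).2) fun j hj hj' => ?_
      exact hs j fun hjs => hj' (Finset.mem_filter.2 ⟨hjs, hj⟩)
    rw [e, ← Finset.prod_filter_mul_prod_filter_not s (· ∈ ν.support)]
    exact mul_le_of_le_one_right (Finset.prod_nonneg fun j _ => (hd j).le)
      (Finset.prod_le_one (fun j _ => (hd j).le) fun j _ => hd1 j)
  calc (∏ j ∈ s, d j) * ν.prod g ≤ (∏ j ∈ ν.support, d j) * ∏ j ∈ ν.support, g j (ν j) := by
        have : 0 ≤ ν.prod g := Finset.prod_nonneg fun j hj => hg j _ (hpos j hj)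
        exact mul_le_mul_of_nonneg_right h1 this
    _ = ∏ j ∈ ν.support, d j * g j (ν j) := Finset.prod_mul_distrib.symm
    _ ≤ _ := Finset.prod_le_prod
        (fun j hj => mul_nonneg (hd j).le (hg j _ (hpos j hj))) fun j hj => hfg j _ (hpos j hj)

/-- There are admissible radii `κ`, with a margin, whose weights dominate `weight K ϱ M` up to a
constant, whatever `K` is: outside a finite set of coordinates, `κ` may be any fixed multiple of
`ϱ`, because the tails of the convergent series are small. -/
lemma exists_radii {b ϱ : ℕ → ℝ} {ξ K : ℝ} {M : ℕ} (hξ : 0 < ξ) (hM : 1 ≤ M) (hK : 0 < K)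
    (hϱ : ∀ j, 0 < ϱ j) (hsum : Summable fun j => b j ^ 2 * ϱ j ^ 2)
    (hfin : {j | K * ϱ j < 1}.Finite) :
    ∃ κ : ℕ → ℝ, (∀ j, 0 < κ j) ∧
      (∀ N, ∑ j ∈ Finset.range N, b j ^ 2 * (2 * κ j) ^ 2 ≤ ξ ^ 2) ∧
      ∃ C : ℝ, 0 < C ∧ ∀ ν : ℕ →₀ ℕ,
        C * weight K ϱ M ν ≤ ν.prod fun j n => shiftWeight (κ j) n := by
  classical
  -- The constant lost in `le_shiftWeight`, compensated by the factor `K * D` between `κ` and `ϱ`.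
  set D : ℝ := (M : ℝ) ^ M * (M ! : ℝ) ^ 2 with hD
  have hD1 : 1 ≤ D := by
    have h1 : (1 : ℝ) ≤ M := by exact_mod_cast hM
    have h2 : (1 : ℝ) ≤ (M ! : ℝ) := by exact_mod_cast Nat.factorial_pos M
    exact one_le_mul_of_one_le_of_one_le (one_le_pow₀ h1) (one_le_pow₀ h2)
  have hD0 : 0 < D := by linarith
  obtain ⟨s₁, hs₁⟩ := summable_iff_vanishing_norm.1 (hsum.mul_left (4 * (K * D) ^ 2))
    (ξ ^ 2 / 2) (by positivity)
  set s : Finset ℕ := s₁ ∪ hfin.toFinset with hs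
  set B : ℝ := ∑ j ∈ s, b j ^ 2 with hB
  have hB0 : 0 ≤ B := Finset.sum_nonneg fun j _ => sq_nonneg _
  set ε : ℝ := √(ξ ^ 2 / (8 * (1 + B))) with hε
  have hε0 : 0 < ε := Real.sqrt_pos.2 (by positivity)
  have hε2 : ε ^ 2 = ξ ^ 2 / (8 * (1 + B)) := Real.sq_sqrt (by positivity)
  set κ : ℕ → ℝ := fun j => if j ∈ s then ε else K * D * ϱ j with hκdef
  have hκ : ∀ j, 0 < κ j := fun j => by
    have := hϱ j
    simp only [hκdef]
    split_ifs <;> positivity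
  refine ⟨κ, hκ, fun N => ?_, ?_⟩
  · rw [← Finset.sum_filter_add_sum_filter_not (Finset.range N) (· ∈ s)]
    have h1 : ∑ j ∈ (Finset.range N).filter (· ∈ s), b j ^ 2 * (2 * κ j) ^ 2 ≤ ξ ^ 2 / 2 := by
      calc ∑ j ∈ (Finset.range N).filter (· ∈ s), b j ^ 2 * (2 * κ j) ^ 2
          = ∑ j ∈ (Finset.range N).filter (· ∈ s), b j ^ 2 * (4 * ε ^ 2) :=
            Finset.sum_congr rfl fun j hj => by
              simp only [hκdef, (Finset.mem_filter.1 hj).2, if_true]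
              ring
        _ ≤ ∑ j ∈ s, b j ^ 2 * (4 * ε ^ 2) :=
            Finset.sum_le_sum_of_subset_of_nonneg (fun j hj => (Finset.mem_filter.1 hj).2)
              fun j _ _ => by positivity
        _ = B * (4 * ε ^ 2) := (Finset.sum_mul _ _ _).symm
        _ = ξ ^ 2 / 2 * (B / (1 + B)) := by
            rw [hε2]
            field_simp
            ring
        _ ≤ ξ ^ 2 / 2 := mul_le_of_le_one_right (by positivity)
            ((div_le_one (by positivity)).2 (by linarith))
    have h2 : ∑ j ∈ (Finset.range N).filter (¬ · ∈ s), b j ^ 2 * (2 * κ j) ^ 2 ≤ ξ ^ 2 / 2 := by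
      have hdisj : Disjoint ((Finset.range N).filter (¬ · ∈ s)) s₁ :=
        Finset.disjoint_left.2 fun j hj hj' =>
          (Finset.mem_filter.1 hj).2 (Finset.mem_union_left _ hj')
      refine le_trans (le_of_eq ?_) ((le_abs_self _).trans (hs₁ _ hdisj).le)
      refine Finset.sum_congr rfl fun j hj => ?_
      simp only [hκdef, (Finset.mem_filter.1 hj).2, if_false]
      ring
    linarith
  · set w : ℕ → ℝ := fun j => max 1 (K * ϱ j) ^ 2 with hw
    have hw1 : ∀ j, 0 < w j := fun j =>
      pow_pos (lt_of_lt_of_le one_pos (le_max_left _ _)) 2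
    set m : ℝ := min (ε ^ 2) (ε ^ (2 * M)) with hm
    have hm0 : 0 < m := lt_min (by positivity) (by positivity)
    refine exists_mul_prod_le (s := s)
      (d := fun j => if j ∈ s then min 1 (m / (D * w j)) else 1) (fun j => ?_) (fun j => ?_)
      (fun j hj => if_neg hj) (fun j n _ => mul_nonneg (hw1 j).le (by positivity))
      fun j n hn => ?_
    · have := hw1 j
      split_ifs
      · exact lt_min one_pos (by positivity)
      · exact one_pos
    · split_ifs
      · exact min_le_left _ _
      · exact le_rfl
    · have hle := le_shiftWeight hM (κ j) hn
      have hwj := hw1 j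
      rw [← hD] at hle
      refine le_of_mul_le_mul_left (le_trans ?_ hle) hD0
      by_cases hj : j ∈ s
      · simp only [hj, if_true, hκdef]
        calc D * (min 1 (m / (D * w j)) * (w j * (n : ℝ) ^ M))
            ≤ D * (m / (D * w j) * (w j * (n : ℝ) ^ M)) := by
              gcongr
              exact min_le_right _ _
          _ = m * (n : ℝ) ^ M := by field_simp
      · have hKϱ : 1 ≤ K * ϱ j := by
          by_contra! hlt
          exact hj (Finset.mem_union_right _ (hfin.mem_toFinset.2 hlt))
        have hκj : κ j = D * (K * ϱ j) := by
          simp only [hκdef, hj, if_false]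
          ring
        have h1 : 1 ≤ κ j := by
          rw [hκj]
          exact one_le_mul_of_one_le_of_one_le hD1 hKϱ
        have h2 : κ j ^ 2 ≤ min (κ j ^ 2) (κ j ^ (2 * M)) :=
          le_min le_rfl (pow_le_pow_right₀ h1 (by omega))
        simp only [hj, if_false, one_mul]
        calc D * (max 1 (K * ϱ j) ^ 2 * (n : ℝ) ^ M)
            = D * (K * ϱ j) ^ 2 * (n : ℝ) ^ M := by
              rw [max_eq_right hKϱ]
              ring
          _ ≤ κ j ^ 2 * (n : ℝ) ^ M := by
              rw [hκj, mul_pow D]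
              gcongr
              exact le_self_pow₀ hD1 two_ne_zero
          _ ≤ _ := by gcongr

/-! ### Summability of negative powers of the weights -/

/-- A product weight over multi-indices is summable if the sums over the single indices are. -/
lemma summable_finsupp_prod {g : ℕ → ℕ → ℝ} {a : ℕ → ℝ} (hg : ∀ j n, 0 ≤ g j n)
    (hg0 : ∀ j, g j 0 = 1) (ha : Summable a) (ha0 : ∀ j, 0 ≤ a j)
    (hga : ∀ j B, ∑ n ∈ Finset.range B, g j (n + 1) ≤ a j) :
    Summable fun ν : ℕ →₀ ℕ => ν.prod g := by
  classical
  refine summable_of_sum_le (c := Real.exp (∑' j, a j))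
    (fun ν => Finset.prod_nonneg fun j _ => hg j _) fun T => ?_
  obtain ⟨N, hN⟩ := exists_forall_supportedBelow T
  have hT := hN N le_rfl
  set B : ℕ := T.sup fun ν => ν.support.sup ν with hB
  have hTB : ∀ ν ∈ T, ∀ j, ν j ≤ B := by
    intro ν hν j
    by_cases hj : j ∈ ν.support
    · exact (Finset.le_sup (f := ν) hj).trans
        (Finset.le_sup (f := fun ν : ℕ →₀ ℕ => ν.support.sup ν) hν)
    · rw [Finsupp.notMem_support_iff.1 hj]
      exact Nat.zero_le _
  have hinj : Set.InjOn (fun (ν : ℕ →₀ ℕ) (j : Fin N) => ν j) T :=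
    fun ν hν ν' hν' e => (hT ν hν).ext (hT ν' hν') (congrFun e)
  calc ∑ ν ∈ T, ν.prod g = ∑ ν ∈ T, ∏ j : Fin N, g j (ν j) :=
        Finset.sum_congr rfl fun ν hν => (hT ν hν).prod_eq g hg0
    _ = ∑ l ∈ T.image fun (ν : ℕ →₀ ℕ) (j : Fin N) => ν j, ∏ j : Fin N, g j (l j) := by
        rw [Finset.sum_image hinj]
    _ ≤ ∑ l ∈ Fintype.piFinset fun _ : Fin N => Finset.range (B + 1), ∏ j : Fin N, g j (l j) := by
        refine Finset.sum_le_sum_of_subset_of_nonneg (fun l hl => ?_)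
          fun l _ _ => Finset.prod_nonneg fun j _ => hg _ _
        obtain ⟨ν, hν, rfl⟩ := Finset.mem_image.1 hl
        exact Fintype.mem_piFinset.2 fun j =>
          Finset.mem_range.2 (Nat.lt_succ_of_le (hTB ν hν j))
    _ = ∏ j : Fin N, ∑ n ∈ Finset.range (B + 1), g j n := by
        rw [Finset.prod_univ_sum]
    _ ≤ ∏ j : Fin N, Real.exp (a j) := by
        refine Finset.prod_le_prod (fun j _ => Finset.sum_nonneg fun n _ => hg _ _) fun j _ => ?_
        rw [Finset.sum_range_succ', hg0]
        exact (add_le_add_left (hga j B) 1).trans (Real.add_one_le_exp _)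
    _ = Real.exp (∑ j ∈ Finset.range N, a j) := by
        rw [← Real.exp_sum, Finset.sum_range]
    _ ≤ _ := Real.exp_le_exp.2 (ha.sum_le_tsum _ fun j _ => ha0 j)

lemma summable_weight_rpow {ϱ : ℕ → ℝ} {K q : ℝ} {M : ℕ} (hK : 0 < K) (hϱ : ∀ j, 0 < ϱ j)
    (hq : 0 < q) (hMq : 1 < M * q) (hsum : Summable fun j => (ϱ j ^ 2) ^ (-q)) :
    Summable fun ν => weight K ϱ M ν ^ (-q) := by
  have hS : Summable fun n : ℕ => ((n + 1 : ℕ) : ℝ) ^ (-(M * q)) :=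
    (summable_nat_add_iff 1).2 (Real.summable_nat_rpow.2 (by linarith))
  set S : ℝ := ∑' n : ℕ, ((n + 1 : ℕ) : ℝ) ^ (-(M * q)) with hSdef
  have hS0 : 0 ≤ S := tsum_nonneg fun n => by positivity
  set g : ℕ → ℕ → ℝ := fun j n =>
    if n = 0 then 1 else (max 1 (K * ϱ j) ^ 2 * (n : ℝ) ^ M) ^ (-q) with hg
  have hbase : ∀ j n : ℕ, 0 ≤ max 1 (K * ϱ j) ^ 2 * (n : ℝ) ^ M := fun j n => by positivity
  have hsmm : Summable fun ν : ℕ →₀ ℕ => ν.prod g := by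
    refine summable_finsupp_prod (a := fun j => (K ^ 2) ^ (-q) * (ϱ j ^ 2) ^ (-q) * S)
      (fun j n => ?_) (fun j => by simp [hg]) ((hsum.mul_left _).mul_right S)
      (fun j => by have := hϱ j; positivity) fun j B => ?_
    · simp only [hg]
      split_ifs
      · exact zero_le_one
      · exact Real.rpow_nonneg (hbase j n) _
    · have hj := hϱ j
      have hterm : ∀ n : ℕ, g j (n + 1) ≤
          (K ^ 2) ^ (-q) * (ϱ j ^ 2) ^ (-q) * ((n + 1 : ℕ) : ℝ) ^ (-(M * q)) := by
        intro n
        have hn : (0 : ℝ) < ((n + 1 : ℕ) : ℝ) := by positivity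
        simp only [hg, Nat.succ_ne_zero, if_false]
        rw [Real.mul_rpow (by positivity) (pow_nonneg hn.le M), ← Real.rpow_natCast _ M,
          ← Real.rpow_mul hn.le, ← mul_neg, ← Real.mul_rpow (sq_nonneg K) (sq_nonneg (ϱ j)),
          ← mul_pow]
        refine mul_le_mul_of_nonneg_right ?_ (by positivity)
        refine Real.rpow_le_rpow_of_nonpos (by positivity) ?_ (by linarith)
        gcongr
        exact le_max_right _ _
      refine (Finset.sum_le_sum fun n _ => hterm n).trans ?_
      rw [← Finset.mul_sum]
      refine mul_le_mul_of_nonneg_left (hS.sum_le_tsum _ fun n _ => ?_) (by positivity)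
      positivity
  refine hsmm.congr fun ν => ?_
  rw [weight, Finsupp.prod, Finsupp.prod, ← Real.finsetProd_rpow _ _ fun j _ => hbase j _]
  refine Finset.prod_congr rfl fun j hj => ?_
  simp only [hg, Finsupp.mem_support_iff.1 hj, if_false]

/-- If the `-q`-th powers of an increasing positive sequence are summable, the sequence grows at
least like `i ^ (1 / q)`. -/
lemma exists_mul_rpow_le_of_monotone {c : ℕ → ℝ} (hc : Monotone c) (hc0 : ∀ i, 0 < c i) {q : ℝ}
    (hq : 0 < q) (hsum : Summable fun i => c i ^ (-q)) :
    ∃ A : ℝ, 0 < A ∧ ∀ N i : ℕ, N ≤ i → A * (N : ℝ) ^ (1 / q) ≤ c i := by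
  set S : ℝ := ∑' i, c i ^ (-q) with hS
  have hS0 : 0 < S := hsum.tsum_pos (fun i => (Real.rpow_pos_of_pos (hc0 i) _).le) 0
    (Real.rpow_pos_of_pos (hc0 0) _)
  refine ⟨S ^ (-(1 / q)), by positivity, fun N i hNi => ?_⟩
  have h1 : (N : ℝ) * c i ^ (-q) ≤ S := by
    calc (N : ℝ) * c i ^ (-q) = ∑ k ∈ Finset.range N, c i ^ (-q) := by simp
      _ ≤ ∑ k ∈ Finset.range N, c k ^ (-q) := Finset.sum_le_sum fun k hk =>
          Real.rpow_le_rpow_of_nonpos (hc0 k)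
            (hc ((Finset.mem_range.1 hk).le.trans hNi)) (by linarith)
      _ ≤ S := hsum.sum_le_tsum _ fun k _ => (Real.rpow_pos_of_pos (hc0 k) _).le
  have hq0 : 0 < c i ^ q := Real.rpow_pos_of_pos (hc0 i) q
  have h2 : S⁻¹ * N ≤ c i ^ q := by
    rw [Real.rpow_neg (hc0 i).le, ← div_eq_mul_inv, div_le_iff₀ hq0] at h1
    rw [inv_mul_le_iff₀ hS0]
    exact h1
  calc S ^ (-(1 / q)) * (N : ℝ) ^ (1 / q) = (S⁻¹ * N) ^ (1 / q) := by
        rw [Real.mul_rpow (by positivity) (by positivity), Real.inv_rpow hS0.le,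
          Real.rpow_neg hS0.le]
    _ ≤ (c i ^ q) ^ (1 / q) := Real.rpow_le_rpow (by positivity) h2 (by positivity)
    _ = c i := by
        rw [← Real.rpow_mul (hc0 i).le, mul_one_div_cancel hq.ne', Real.rpow_one]

/-! ### The convergence rate -/

lemma lpQuasiNorm_pos {p : ℝ} {b : ℕ → ℝ} (hb : ∀ j, 0 < b j)
    (hbp : Summable fun j => b j ^ p) : 0 < lpQuasiNorm p b :=
  Real.rpow_pos_of_pos (hbp.tsum_pos (fun j => (Real.rpow_pos_of_pos (hb j) p).le) 0
    (Real.rpow_pos_of_pos (hb 0) p)) _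

section Radii

variable {b ϱ : ℕ → ℝ} {p A : ℝ}

lemma sq_eq_mul_rpow (hb : ∀ j, 0 < b j)
    (h : ∀ j, ϱ j ^ 2 * b j ^ 2 = A * b j ^ p) (j : ℕ) : ϱ j ^ 2 = A * b j ^ (p - 2) := by
  have hbj := hb j
  rw [Real.rpow_sub hbj, mul_div_assoc', ← h j, Real.rpow_two, mul_div_cancel_right₀]
  positivity

/-- Since `b j → 0` and `p < 2`, the radii `ϱ j` tend to infinity. -/
lemma finite_setOf_mul_lt_one (hp0 : 0 < p) (hp2 : p < 2) (hb : ∀ j, 0 < b j)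
    (hbp : Summable fun j => b j ^ p) (hA : 0 < A) (hϱ : ∀ j, 0 < ϱ j)
    (h : ∀ j, ϱ j ^ 2 * b j ^ 2 = A * b j ^ p) {K : ℝ} (hK : 0 < K) :
    {j | K * ϱ j < 1}.Finite := by
  have h0 : Tendsto (fun j => (b j ^ p) ^ ((2 - p) / p)) cofinite (𝓝 0) := by
    have := hbp.tendsto_cofinite_zero.rpow_const (p := (2 - p) / p)
      (Or.inr (div_pos (by linarith) hp0).le)
    rwa [Real.zero_rpow (div_pos (by linarith) hp0).ne'] at this
  have hev := h0.eventually_lt_const (show (0 : ℝ) < K ^ 2 * A by positivity)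
  refine (Filter.eventually_cofinite.1 hev).subset fun j hj hlt => ?_
  have hbj := hb j
  have hϱj := hϱ j
  have e : (b j ^ p) ^ ((2 - p) / p) * b j ^ (p - 2) = 1 := by
    rw [← Real.rpow_mul hbj.le, mul_div_cancel₀ _ hp0.ne', ← Real.rpow_add hbj]
    simp
  have h1 : 1 < (K * ϱ j) ^ 2 := by
    rw [mul_pow, sq_eq_mul_rpow hb h, ← mul_assoc, ← e]
    exact mul_lt_mul_of_pos_right hlt (Real.rpow_pos_of_pos hbj _)
  have h2 : K * ϱ j < 1 := hj
  have h3 : (K * ϱ j) ^ 2 < 1 := pow_lt_one₀ (by positivity) h2 two_ne_zero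
  linarith

lemma summable_sq_rpow_neg (hp2 : p < 2) (hb : ∀ j, 0 < b j)
    (hbp : Summable fun j => b j ^ p) (hA : 0 < A)
    (h : ∀ j, ϱ j ^ 2 * b j ^ 2 = A * b j ^ p) :
    Summable fun j => (ϱ j ^ 2) ^ (-(p / (2 - p))) := by
  refine (hbp.mul_left (A ^ (-(p / (2 - p))))).congr fun j => ?_
  have hbj := hb j
  have h2p : 2 - p ≠ 0 := by linarith
  rw [sq_eq_mul_rpow hb h, Real.mul_rpow hA.le (Real.rpow_pos_of_pos hbj _).le,
    ← Real.rpow_mul hbj.le]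
  congr 2
  field_simp
  ring

end Radii

/-- If the weighted sum of the squared norms of the Hermite coefficients is finite and the weights
grow along an enumeration, then the truncations converge at the corresponding rate. -/
lemma eLpNorm_sub_truncation_le {X : Type*} [NormedAddCommGroup X] [InnerProductSpace ℂ X]
    [CompleteSpace X] [SecondCountableTopology X] {u : (ℕ → ℝ) → X} (hu : MemLp u 2 gammaInf)
    {w : (ℕ →₀ ℕ) → ℝ} {δ r : ℝ} (hδ : 0 ≤ δ) (hr : 0 < r)
    (hw : ∀ s : Finset (ℕ →₀ ℕ), ∑ ν ∈ s, w ν * ‖hermiteCoeff u ν‖ ^ 2 ≤ δ ^ 2)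
    (Λ : Finset (ℕ →₀ ℕ)) (hΛ : ∀ ν ∉ Λ, r ≤ w ν) :
    eLpNorm (fun y => u y - truncation u Λ y) 2 gammaInf ≤
      ENNReal.ofReal (δ * r ^ (-(1 / 2) : ℝ)) := by
  have key := isOrthonormalSystem_hermiteC.eLpNorm_sub_sum_le eq_zero_of_coeffWith_hermiteC hu
    Λ (B := δ * r ^ (-(1 / 2) : ℝ)) (by positivity) fun t ht => ?_
  · simpa only [coeffWith_hermiteC, hermiteC, Complex.coe_smul, truncation] using key
  · simp only [coeffWith_hermiteC]
    have hB : (δ * r ^ (-(1 / 2) : ℝ)) ^ 2 = δ ^ 2 / r := by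
      rw [mul_pow, ← Real.rpow_natCast (r ^ (-(1 / 2) : ℝ)), ← Real.rpow_mul hr.le]
      norm_num
      rw [Real.rpow_neg_one, div_eq_mul_inv]
    rw [hB, le_div_iff₀ hr, Finset.sum_mul]
    refine (Finset.sum_le_sum fun ν hν => ?_).trans (hw t)
    rw [mul_comm]
    exact mul_le_mul_of_nonneg_right (hΛ ν (Finset.disjoint_left.1 ht hν)) (sq_nonneg _)

end HermiteApprox

theorem theorem4p2 {X : Type*} [NormedAddCommGroup X] [InnerProductSpace ℂ X] [CompleteSpace X]
    [TopologicalSpace.SeparableSpace X]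
    (b : ℕ → ℝ) (hb : ∀ j, 0 < b j) (ξ δ : ℝ) (hξ : 0 < ξ) (hδ : 0 < δ)
    (p : ℝ) (hp0 : 0 < p) (hp2 : p < 2) (hbp : Summable fun j => b j ^ p)
    (u : (ℕ → ℝ) → X) (hu : HermiteApprox.IsHolomorphic b ξ δ u)
    (M : ℕ) (hM : 2 / p < (M : ℝ))
    (ϱ : ℕ → ℝ) (hϱ : ∀ j, 0 < ϱ j)
    (hϱb : ∀ j, ϱ j ^ 2 * b j ^ 2 =
      (b j / HermiteApprox.lpQuasiNorm p b) ^ p * (ξ ^ 2 / (8 * Real.exp 1 * (M ! : ℝ))))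
    (K : ℝ) (hK : 0 < K)
    (e : ℕ ≃ (ℕ →₀ ℕ)) (he : Monotone fun i => HermiteApprox.weight K ϱ M (e i)) :
    ∃ C : ℝ, 0 < C ∧ ∀ N : ℕ, 1 ≤ N →
      eLpNorm (fun y => u y - HermiteApprox.truncation u (HermiteApprox.firstIndices e N) y) 2
          HermiteApprox.gammaInf
        ≤ ENNReal.ofReal (C * (N : ℝ) ^ (-1 / p + 1 / 2)) := by
  open HermiteApprox in
  have : SecondCountableTopology X := UniformSpace.secondCountable_of_separable X
  have hn := lpQuasiNorm_pos hb hbp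
  obtain ⟨A, hA, hAb⟩ : ∃ A : ℝ, 0 < A ∧ ∀ j, ϱ j ^ 2 * b j ^ 2 = A * b j ^ p := by
    refine ⟨(lpQuasiNorm p b ^ p)⁻¹ * (ξ ^ 2 / (8 * Real.exp 1 * (M ! : ℝ))), by positivity,
      fun j => ?_⟩
    rw [hϱb j, Real.div_rpow (hb j).le hn.le]
    ring
  have hM1 : 1 ≤ M := by
    have : (0 : ℝ) < M := lt_trans (by positivity) hM
    exact_mod_cast this
  -- For this exponent `(ϱ j ^ 2) ^ (-q)` is a multiple of `b j ^ p`, and `1 / q = 2 / p - 1`.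
  set q : ℝ := p / (2 - p) with hq
  have h2p : 0 < 2 - p := by linarith
  have hq0 : 0 < q := by positivity
  have hMq : 1 < M * q := by
    rw [hq, mul_div_assoc', lt_div_iff₀ h2p]
    rw [div_lt_iff₀ hp0] at hM
    linarith
  obtain ⟨κ, hκ, hadm, C, hC, hCw⟩ := exists_radii hξ hM1 hK hϱ
    ((hbp.mul_left A).congr fun j => by rw [← hAb j, mul_comm])
    (finite_setOf_mul_lt_one hp0 hp2 hb hbp hA hϱ hAb hK)
  have hsum := summable_weight_rpow hK hϱ hq0 hMq (summable_sq_rpow_neg hp2 hb hbp hA hAb)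
  obtain ⟨a, ha, hgrow⟩ := exists_mul_rpow_le_of_monotone he (fun i => weight_pos K ϱ M (e i)) hq0
    (e.summable_iff.2 hsum)
  refine ⟨δ * (C * a) ^ (-(1 / 2) : ℝ), by positivity, fun N hN => ?_⟩
  have hN0 : (0 : ℝ) < N := by exact_mod_cast hN
  refine (eLpNorm_sub_truncation_le hu.1 hδ.le (r := C * a * (N : ℝ) ^ (1 / q)) (by positivity)
    (hu.sum_prod_shiftWeight_mul_le hδ.le hκ hadm) _ fun ν hν => ?_).trans
    (ENNReal.ofReal_le_ofReal (le_of_eq ?_))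
  · have hi : N ≤ e.symm ν := by
      by_contra! hlt
      exact hν (Finset.mem_map.2 ⟨e.symm ν, Finset.mem_range.2 hlt, e.apply_symm_apply ν⟩)
    have h1 := hgrow N _ hi
    simp only [e.apply_symm_apply] at h1
    refine le_trans ?_ (hCw ν)
    rw [mul_assoc]
    gcongr
  · rw [Real.mul_rpow (by positivity) (by positivity), ← Real.rpow_mul hN0.le, mul_assoc]
    congr 3
    rw [hq]
    field_simp
    ring
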